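/- Let $p$ be a prime, let $e,m,k\ge 1$ be integers, and let $q=p^e$. For $a\in\mathbb{N}$ let $S_p(a)$ be the sum of the base-$p$ digits of $a$, and let $\nu_p$ be the $p$-adic valuation, with $\nu_p(0)=\infty$. For $f\in\mathbb{F}_{q^m}[x_1,\ldots,x_k]$ let $\mathrm{Deg}(f)$ be the set of degrees of the nonzero homogeneous parts of $f$, and let $N(f=y^q-y)$ be the number of $(x_1,\ldots,x_k,y)\in\mathbb{F}_{q^m}^{k+1}$ with $f(x_1,\ldots,x_k)=y^q-y$. Let $D\subseteq\{0,1,\ldots,k(q^m-1)\}$ be nonempty with $D\ne\{0\}$, and put $$\mathcal{T}_D=\{t=(t_1,\ldots,t_k)\in\{0,\ldots,q^m-1\}^k : t_1+\cdots+t_k\in D\}.$$ Let $\mu_D$ be the minimum of $$\frac{1}{p-1}\sum_{t\in\mathcal{T}_D}S_p(r_t)$$ over all $r=(r_t)_{t\in\mathcal{T}_D}\in\{0,\ldots,q^m-1\}^{\mathcal{T}_D}$ such that $\sum_{t\in\mathcal{T}_D}r_t\equiv 0\pmod{q-1}$ and, for every $1\le i\le k$, $\sum_{t\in\mathcal{T}_D}r_t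 t_i$ is a positive multiple of $q^m-1$. Then such $r$ exist, so that $\mu_D$ is well defined, and: 1. for every $f\in\mathbb{F}_{q^m}[x_1,\ldots,x_k]$ with $\mathrm{Deg}(f)\subseteq D$, $\nu_p(N(f=y^q-y))\ge\mu_D$; 2. there is an $f\in\mathbb{F}_{q^m}[x_1,\ldots,x_k]$ with $\mathrm{Deg}(f)\subseteq D$ and $\nu_p(N(f=y^q-y))=\mu_D$. -/

import Mathlib

/-- The sum of the digits of `a` in base `p`. -/
def digitSum (p a : ℕ) : ℕ := (Nat.digits p a).sum

/-- The `p`-adic valuation of a natural number, with value `⊤` (infinity) at `0`. -/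
noncomputable def valP (p N : ℕ) : WithTop ℚ :=
  if N = 0 then ⊤ else ((padicValNat p N : ℚ) : WithTop ℚ)

/-- The set of degrees of the nonzero homogeneous parts of a polynomial. -/
def degreeSet {k : ℕ} {F : Type*} [CommSemiring F] (f : MvPolynomial (Fin k) F) : Set ℕ :=
  {d | MvPolynomial.homogeneousComponent d f ≠ 0}

/-- The number of solutions `(x, y)` in `F ^ k × F` of `f(x) = y ^ q - y`. -/
noncomputable def numSolutions {k : ℕ} {F : Type*} [CommRing F] (q : ℕ)
    (f : MvPolynomial (Fin k) F) : ℕ :=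
  Nat.card {z : (Fin k → F) × F // MvPolynomial.eval z.1 f = z.2 ^ q - z.2}

/-- The exponent vectors in `[0, Q - 1] ^ k` whose total degree lies in `D`. -/
def exponentSet (Q k : ℕ) (D : Finset ℕ) : Finset (Fin k → ℕ) :=
  (Fintype.piFinset fun _ : Fin k => Finset.Icc 0 (Q - 1)).filter fun t => ∑ i, t i ∈ D

/-- The constraints of the program, for a vector `r` indexed by the exponent vectors. -/
structure Feasible (q m k : ℕ) (D : Finset ℕ) (r : exponentSet (q ^ m) k D → ℕ) : Prop where
  le : ∀ t, r t ≤ q ^ m - 1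
  sum_modEq : ∑ t, r t ≡ 0 [MOD q - 1]
  weighted_pos : ∀ i : Fin k, 0 < ∑ t, r t * t.1 i
  weighted_dvd : ∀ i : Fin k, q ^ m - 1 ∣ ∑ t, r t * t.1 i

/-- The objective `(1 / (p - 1)) * ∑ S_p(r_t)`. -/
def objective (p Q k : ℕ) (D : Finset ℕ) (r : exponentSet Q k D → ℕ) : ℚ :=
  1 / ((p : ℚ) - 1) * ∑ t, (digitSum p (r t) : ℚ)

/-!
Summing an additive character of trace type over the dual variable turns the number of solutions
into a character sum. Expanding the character in powers of the Teichmüller character, the number of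
solutions becomes a polynomial in the Teichmüller lifts of the coefficients of `f`. Its coefficient
at `r` vanishes unless the weighted sums of `r` satisfy the congruences of the program; otherwise,
by Stickelberger's theorem, its valuation, measured in units of the valuation of `ζ - 1` (that is,
`1 / (p - 1)` of the valuation of `p`), is at least the digit sum of `r` plus the valuation of the
field size for every weighted column sum that is zero, with equality when all column sums are
positive.

Such an `r` is turned into a feasible point of no larger cost: a zero column is filled at exactly
the price already paid for it, and casting out multiples of `p ^ n - 1` does not increase digit
sums. Reduced exponent vectors may fall short of the prescribed total degrees by multiples of
`q ^ m - 1`; entries `0` are then replaced by `q ^ m - 1`, after merging two columns when too few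
entries are `0`. This gives the lower bound.

For attainment, Teichmüller lifts are pairwise distinct modulo the maximal ideal, so the Lagrange
basis on them is integral and each coefficient of the polynomial is an integral combination of its
values. Hence some choice of the coefficients of `f` gives a value whose valuation does not exceed
that of the coefficient at a minimizer, namely its digit sum.
-/

open Finset

section DigitSum

variable {p : ℕ}

theorem digitSum_zero (p : ℕ) : digitSum p 0 = 0 := by simp [digitSum]

theorem digitSum_mul_add (hp : 1 < p) (n : ℕ) {d : ℕ} (hd : d < p) :
    digitSum p (p * n + d) = digitSum p n + d := by
  rcases Nat.eq_zero_or_pos (p * n + d) with h | h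
  · obtain ⟨h1, rfl⟩ : p * n = 0 ∧ d = 0 := by omega
    have : n = 0 := by simpa [show p ≠ 0 by omega] using h1
    simp [this, digitSum]
  · unfold digitSum
    rw [Nat.digits_def' hp h, List.sum_cons, Nat.mul_add_mod, Nat.mod_eq_of_lt hd,
      Nat.mul_add_div (by omega), Nat.div_eq_of_lt hd, add_zero, add_comm]

theorem digitSum_eq_div_add_mod (hp : 1 < p) (n : ℕ) :
    digitSum p n = digitSum p (n / p) + n % p := by
  conv_lhs => rw [← Nat.div_add_mod n p]
  exact digitSum_mul_add hp _ (Nat.mod_lt _ (by omega))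

theorem digitSum_pow_mul_add (hp : 1 < p) {n : ℕ} (h : ℕ) {l : ℕ} (hl : l < p ^ n) :
    digitSum p (p ^ n * h + l) = digitSum p h + digitSum p l := by
  induction n generalizing l with
  | zero =>
    obtain rfl : l = 0 := by simpa using hl
    simp [digitSum]
  | succ n ih =>
    have hl' : l / p < p ^ n := Nat.div_lt_of_lt_mul (by rwa [pow_succ'] at hl)
    have hmod : l % p < p := Nat.mod_lt _ (by omega)
    have : p ^ (n + 1) * h + l = p * (p ^ n * h + l / p) + l % p := by
      conv_lhs => rw [← Nat.div_add_mod l p]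
      ring
    rw [this, digitSum_mul_add hp _ hmod, ih hl', digitSum_eq_div_add_mod hp l, add_assoc]

theorem digitSum_add_digitSum_compl (hp : 1 < p) {n r : ℕ} (hr : r < p ^ n) :
    digitSum p r + digitSum p (p ^ n - 1 - r) = n * (p - 1) := by
  induction n generalizing r with
  | zero =>
    obtain rfl : r = 0 := by simpa using hr
    simp [digitSum]
  | succ n ih =>
    have hr' : r / p < p ^ n := Nat.div_lt_of_lt_mul (by rwa [pow_succ'] at hr)
    have hmod : r % p < p := Nat.mod_lt _ (by omega)
    have hcompl : p ^ (n + 1) - 1 - r = p * (p ^ n - 1 - r / p) + (p - 1 - r % p) := by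
      conv_lhs => rw [← Nat.div_add_mod r p, pow_succ']
      obtain ⟨c, hc⟩ : ∃ c, p ^ n = r / p + 1 + c := ⟨p ^ n - (r / p + 1), by omega⟩
      rw [show p ^ n - 1 - r / p = c by omega, hc, mul_add, mul_add]
      omega
    rw [hcompl, digitSum_mul_add hp _ (by omega), digitSum_eq_div_add_mod hp r, add_mul, ← ih hr']
    omega

theorem digitSum_pow_sub_one (hp : 1 < p) (n : ℕ) : digitSum p (p ^ n - 1) = n * (p - 1) := by
  simpa [digitSum_zero] using digitSum_add_digitSum_compl hp (r := 0) (n := n) (by positivity)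

theorem digitSum_mul_left (hp : 1 < p) (n : ℕ) : digitSum p (p * n) = digitSum p n :=
  digitSum_mul_add hp n (d := 0) (by omega)

theorem digitSum_add_one_of_not_dvd (hp : 1 < p) {n : ℕ} (hn : ¬p ∣ n + 1) :
    digitSum p (n + 1) = digitSum p n + 1 := by
  have hmod : n % p < p := Nat.mod_lt _ (by omega)
  have hdiv := Nat.div_add_mod n p
  have hne : n % p + 1 ≠ p := fun h => hn ⟨n / p + 1, by rw [mul_add, mul_one]; omega⟩
  rw [show n + 1 = p * (n / p) + (n % p + 1) by omega, digitSum_mul_add hp _ (by omega),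
    digitSum_eq_div_add_mod hp n, add_assoc]

theorem digitSum_add_one_le (hp : 1 < p) (n : ℕ) : digitSum p (n + 1) ≤ digitSum p n + 1 := by
  induction n using Nat.strong_induction_on with
  | _ n ih =>
    by_cases hdvd : p ∣ n + 1
    · have hmod : n % p < p := Nat.mod_lt _ (by omega)
      have hdiv := Nat.div_add_mod n p
      have hcarry : n % p + 1 = p := by
        have : p ∣ n % p + 1 := (Nat.dvd_add_right (dvd_mul_right p (n / p))).1
          (by rwa [← add_assoc, hdiv])
        exact le_antisymm hmod (Nat.le_of_dvd (by omega) this)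
      have hn : n + 1 = p * (n / p + 1) := by rw [mul_add, mul_one]; omega
      have hlt : n / p < n := Nat.div_lt_self (by have := Nat.mod_le n p; omega) hp
      rw [hn, digitSum_mul_left hp, digitSum_eq_div_add_mod hp n]
      exact (ih _ hlt).trans (by omega)
    · exact (digitSum_add_one_of_not_dvd hp hdvd).le

theorem digitSum_add_le (hp : 1 < p) (a b : ℕ) :
    digitSum p (a + b) ≤ digitSum p a + digitSum p b := by
  induction a using Nat.strong_induction_on generalizing b with
  | _ a ih =>
    rcases Nat.eq_zero_or_pos a with rfl | ha
    · simp
    have ha' := Nat.div_add_mod a p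
    have hb' := Nat.div_add_mod b p
    have hmod : a % p < p ∧ b % p < p := ⟨Nat.mod_lt _ (by omega), Nat.mod_lt _ (by omega)⟩
    have hdiv := ih _ (Nat.div_lt_self ha hp) (b / p)
    rw [digitSum_eq_div_add_mod hp a, digitSum_eq_div_add_mod hp b]
    by_cases hcarry : a % p + b % p < p
    · rw [show a + b = p * (a / p + b / p) + (a % p + b % p) by rw [mul_add]; omega,
        digitSum_mul_add hp _ hcarry]
      omega
    · rw [show a + b = p * (a / p + b / p + 1) + (a % p + b % p - p) by
          rw [mul_add, mul_add]; omega,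
        digitSum_mul_add hp _ (by omega)]
      have := digitSum_add_one_le hp (a / p + b / p)
      omega

theorem digitSum_sum_le (hp : 1 < p) {ι : Type*} (s : Finset ι) (w : ι → ℕ) :
    digitSum p (∑ i ∈ s, w i) ≤ ∑ i ∈ s, digitSum p (w i) :=
  le_sum_of_subadditive _ (digitSum_zero p).le (digitSum_add_le hp) s w

end DigitSum

section Residue

/-- The representative of `R` modulo `P` in `[1, P]` if `R` is positive, and `0` if `R = 0`. Unlike
`R % P` it preserves positivity, as the constraints on exponents and weights require. -/
def residue (P R : ℕ) : ℕ := if R = 0 then 0 else (R - 1) % P + 1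

variable {P R S : ℕ}

theorem residue_zero (P : ℕ) : residue P 0 = 0 := if_pos rfl

theorem residue_of_pos (hR : 0 < R) : residue P R = (R - 1) % P + 1 := if_neg hR.ne'

theorem residue_pos (hR : 0 < R) : 0 < residue P R := by
  rw [residue_of_pos hR]
  exact Nat.succ_pos _

theorem residue_le (hP : 0 < P) (R : ℕ) : residue P R ≤ P := by
  rcases Nat.eq_zero_or_pos R with rfl | hR
  · simp [residue_zero]
  · rw [residue_of_pos hR]
    exact Nat.mod_lt _ hP

theorem residue_le_self (P R : ℕ) : residue P R ≤ R := by
  rcases Nat.eq_zero_or_pos R with rfl | hR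
  · simp [residue_zero]
  · rw [residue_of_pos hR]
    have := Nat.mod_le (R - 1) P
    omega

theorem residue_modEq (P R : ℕ) : residue P R ≡ R [MOD P] := by
  rcases Nat.eq_zero_or_pos R with rfl | hR
  · simp [residue_zero, Nat.ModEq]
  · rw [residue_of_pos hR]
    simpa [Nat.sub_add_cancel hR] using (Nat.mod_modEq (R - 1) P).add_right 1

theorem residue_eq_self (hR : R ≤ P) : residue P R = R := by
  rcases Nat.eq_zero_or_pos R with rfl | hpos
  · exact residue_zero P
  · rw [residue_of_pos hpos, Nat.mod_eq_of_lt (by omega), Nat.sub_add_cancel hpos]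

theorem residue_congr (hR : 0 < R) (hS : 0 < S) (h : R ≡ S [MOD P]) :
    residue P R = residue P S := by
  rw [residue_of_pos hR, residue_of_pos hS]
  congr 1
  refine Nat.ModEq.add_right_cancel' 1 ?_
  rwa [Nat.sub_add_cancel hR, Nat.sub_add_cancel hS]

theorem digitSum_residue_le {p : ℕ} (hp : 1 < p) {n : ℕ} (hn : 0 < n) (R : ℕ) :
    digitSum p (residue (p ^ n - 1) R) ≤ digitSum p R := by
  induction R using Nat.strong_induction_on with
  | _ R ih =>
    have hpn : 1 < p ^ n := Nat.one_lt_pow hn.ne' hp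
    by_cases hR : R < p ^ n
    · rw [residue_eq_self (by omega)]
    -- Casting out `p ^ n - 1`: the top part `h` and the bottom part `l` of the digits are added.
    obtain ⟨h, l, hl, rfl⟩ : ∃ h l, l < p ^ n ∧ R = p ^ n * h + l :=
      ⟨R / p ^ n, R % p ^ n, Nat.mod_lt _ (by omega), (Nat.div_add_mod R (p ^ n)).symm⟩
    have hh : 0 < h := Nat.pos_of_ne_zero fun h0 => hR (by rwa [h0, mul_zero, zero_add])
    have hlt : h + l < p ^ n * h + l := by nlinarith
    have hmod : p ^ n * h + l ≡ h + l [MOD p ^ n - 1] := by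
      have : p ^ n ≡ 1 [MOD p ^ n - 1] := ((Nat.modEq_iff_dvd' hpn.le).2 dvd_rfl).symm
      simpa using (this.mul_right h).add_right l
    rw [residue_congr (by omega) (by omega) hmod, digitSum_pow_mul_add hp h hl]
    exact (ih _ hlt).trans (digitSum_add_le hp h l)

end Residue

section RowSystem

variable {ι κ : Type*} {P : ℕ} {w d : ι → ℕ} {t : ι → κ → ℕ}

theorem exists_le_sum_eq_of_sum_le [Fintype κ] {N : ℕ} {x : κ → ℕ} (hx : ∀ i, x i ≤ P)
    (hle : ∑ i, x i ≤ N) (hmod : ∑ i, x i ≡ N [MOD P]) (hN : N ≤ ∑ i, x i + P * #{i | x i = 0}) :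
    ∃ y : κ → ℕ, (∀ i, x i ≤ y i) ∧ (∀ i, y i ≤ P) ∧ (∀ i, y i ≡ x i [MOD P]) ∧
      ∑ i, y i = N := by
  classical
  obtain ⟨f, hf⟩ := (Nat.modEq_iff_dvd' hle).1 hmod
  rcases Nat.eq_zero_or_pos P with rfl | hP
  · exact ⟨x, fun _ => le_rfl, hx, fun _ => rfl, by omega⟩
  have hf_le : f ≤ #{i | x i = 0} := Nat.le_of_mul_le_mul_left (by omega) hP
  obtain ⟨A, hA, hA_card⟩ := exists_subset_card_eq hf_le
  have hA_zero : ∀ i ∈ A, x i = 0 := fun i hi => by simpa using hA hi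
  refine ⟨fun i => x i + if i ∈ A then P else 0, fun i => by simp, fun i => ?_, fun i => ?_, ?_⟩
  · by_cases hi : i ∈ A
    · simp [hi, hA_zero i hi]
    · simpa [hi] using hx i
  · by_cases hi : i ∈ A <;> simp [hi, Nat.ModEq]
  · rw [sum_add_distrib, sum_ite_mem, univ_inter, sum_const, hA_card, smul_eq_mul, mul_comm f]
    omega

theorem exists_ne_of_sum_add_le [Fintype κ] {x : κ → ℕ} (hP : 0 < P)
    (hx : ∑ i, x i + P * #{i | x i = 0} + P ≤ Fintype.card κ * P) :
    ∃ i j, i ≠ j ∧ (0 < x i ∧ x i < P) ∧ 0 < x j ∧ x j < P := by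
  classical
  suffices h : 1 < #{i | 0 < x i ∧ x i < P} by
    obtain ⟨i, hi, j, hj, hij⟩ := one_lt_card.1 h
    exact ⟨i, j, hij, by simpa using hi, by simpa using hj⟩
  by_contra! hcard
  have hpoint : ∀ i, P + (if 0 < x i ∧ x i < P then 1 else 0) ≤
      x i + (if x i = 0 then P else 0) + if 0 < x i ∧ x i < P then P else 0 := by
    intro i
    split_ifs <;> omega
  have hsum := sum_le_sum fun i (_ : i ∈ univ) => hpoint i
  simp only [sum_add_distrib, sum_const, card_univ, smul_eq_mul, ← sum_filter, mul_one] at hsum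
  rw [mul_comm _ P] at hx hsum
  interval_cases #{i | 0 < x i ∧ x i < P} <;> rw [mul_comm _ P] at hsum <;> omega

/-- A family of rows in `[0, P] ^ κ` whose row sums do not exceed prescribed values congruent to
them, and whose weighted column sums are multiples of `P`, with no zero column. The rows are
exponent vectors reduced modulo `P`, to be modified until the row sums attain the prescribed
degrees. -/
structure RowSystem [Fintype ι] [Fintype κ] (P : ℕ) (w d : ι → ℕ) (t : ι → κ → ℕ) : Prop where
  le : ∀ s i, t s i ≤ P
  sum_le : ∀ s, ∑ i, t s i ≤ d s
  sum_modEq : ∀ s, ∑ i, t s i ≡ d s [MOD P]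
  weighted : ∀ i, ∑ s, w s * t s i ≡ 0 [MOD P]
  pos : ∀ i, ∃ s, 0 < t s i

/-- Add column `j` to column `i`, reducing modulo `P`, and refill column `j` by the single entry
`P` in row `s₀`. -/
def mergeColumns [DecidableEq ι] [DecidableEq κ] (P : ℕ) (i j : κ) (s₀ : ι) (t : ι → κ → ℕ) :
    ι → κ → ℕ := fun s =>
  Function.update (Function.update (t s) i (residue P (t s i + t s j))) j
    (if s = s₀ then P else 0)

section MergeColumns

variable [DecidableEq ι] [DecidableEq κ] {i j l : κ} {s₀ : ι}

theorem mergeColumns_right (s : ι) : mergeColumns P i j s₀ t s j = if s = s₀ then P else 0 :=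
  Function.update_self ..

theorem mergeColumns_left (hij : i ≠ j) (s : ι) :
    mergeColumns P i j s₀ t s i = residue P (t s i + t s j) := by
  rw [mergeColumns, Function.update_of_ne hij, Function.update_self]

theorem mergeColumns_of_ne (hi : l ≠ i) (hj : l ≠ j) (s : ι) :
    mergeColumns P i j s₀ t s l = t s l := by
  rw [mergeColumns, Function.update_of_ne hj, Function.update_of_ne hi]

theorem sum_mergeColumns_add [Fintype κ] (hij : i ≠ j) (s : ι) :
    ∑ l, mergeColumns P i j s₀ t s l + (t s i + t s j) =
      ∑ l, t s l + (residue P (t s i + t s j) + if s = s₀ then P else 0) := by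
  have hsplit : ∀ x : κ → ℕ, ∑ l, x l = x i + (x j + ∑ l ∈ (univ.erase i).erase j, x l) :=
    fun x => by
      rw [add_sum_erase _ x (mem_erase.2 ⟨hij.symm, mem_univ j⟩), add_sum_erase _ x (mem_univ i)]
  have hrest : ∑ l ∈ (univ.erase i).erase j, mergeColumns P i j s₀ t s l =
      ∑ l ∈ (univ.erase i).erase j, t s l :=
    sum_congr rfl fun l hl => by
      simp only [mem_erase, mem_univ, and_true] at hl
      exact mergeColumns_of_ne hl.2 hl.1 s
  rw [hsplit, hsplit (t s), mergeColumns_left hij, mergeColumns_right, hrest]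
  omega

theorem RowSystem.mergeColumns [Fintype ι] [Fintype κ] (h : RowSystem P w d t) (hP : 0 < P)
    (hij : i ≠ j) (hs₀ : ∑ l, t s₀ l + P ≤ d s₀) :
    RowSystem P w d (mergeColumns P i j s₀ t) where
  le s l := by
    rcases eq_or_ne l j with rfl | hj
    · rw [mergeColumns_right]
      split_ifs <;> omega
    rcases eq_or_ne l i with rfl | hi
    · rw [mergeColumns_left hij]
      exact residue_le hP _
    · rw [mergeColumns_of_ne hi hj]
      exact h.le s l
  sum_le s := by
    have hsum := sum_mergeColumns_add (P := P) (s₀ := s₀) (t := t) hij s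
    have hres := residue_le_self P (t s i + t s j)
    have := h.sum_le s
    split_ifs at hsum with hs
    · subst hs; omega
    · omega
  sum_modEq s := by
    refine Nat.ModEq.trans ?_ (h.sum_modEq s)
    refine (residue_modEq P (t s i + t s j)).symm.add_right_cancel ?_
    rw [sum_mergeColumns_add hij]
    split_ifs
    · simp [Nat.ModEq, ← add_assoc]
    · rfl
  weighted l := by
    rcases eq_or_ne l j with rfl | hj
    · simp only [mergeColumns_right, mul_ite, mul_zero, sum_ite_eq', mem_univ, if_true]
      exact (Nat.modEq_zero_iff_dvd).2 (dvd_mul_left P _)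
    rcases eq_or_ne l i with rfl | hi
    · simp only [mergeColumns_left hij]
      refine (Nat.ModEq.sum fun s _ => (residue_modEq P _).mul_left _).trans ?_
      simpa only [mul_add, sum_add_distrib] using (h.weighted l).add (h.weighted j)
    · simpa only [mergeColumns_of_ne hi hj] using h.weighted l
  pos l := by
    rcases eq_or_ne l j with rfl | hj
    · exact ⟨s₀, by simpa [mergeColumns_right] using hP⟩
    rcases eq_or_ne l i with rfl | hi
    · obtain ⟨s, hs⟩ := h.pos l
      exact ⟨s, by rw [mergeColumns_left hij]; exact residue_pos (by omega)⟩
    · obtain ⟨s, hs⟩ := h.pos l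
      exact ⟨s, by rwa [mergeColumns_of_ne hi hj]⟩

end MergeColumns

/-- The columns with an entry strictly between `0` and `P`: the progress measure for merging
columns. -/
def mixedColumns (P : ℕ) (t : ι → κ → ℕ) : Set κ := {i | ∃ s, 0 < t s i ∧ t s i < P}

theorem mixedColumns_mergeColumns_ssubset [DecidableEq ι] [DecidableEq κ] {i j : κ}
    (hi : i ∈ mixedColumns P t) (hj : j ∈ mixedColumns P t) (s₀ : ι) :
    mixedColumns P (mergeColumns P i j s₀ t) ⊂ mixedColumns P t := by
  have hj' : j ∉ mixedColumns P (mergeColumns P i j s₀ t) := by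
    rintro ⟨s, hs⟩
    rw [mergeColumns_right] at hs
    split_ifs at hs <;> omega
  refine (Set.ssubset_iff_of_subset fun l hl => ?_).2 ⟨j, hj, hj'⟩
  rcases eq_or_ne l i with rfl | hli
  · exact hi
  · have hlj : l ≠ j := fun h => hj' (h ▸ hl)
    obtain ⟨s, hs⟩ := hl
    exact ⟨s, by rwa [mergeColumns_of_ne hli hlj] at hs⟩

theorem RowSystem.exists_sum_eq [Fintype ι] [Fintype κ] (h : RowSystem P w d t) (hP : 0 < P)
    (hd : ∀ s, d s ≤ Fintype.card κ * P) :
    ∃ t' : ι → κ → ℕ, RowSystem P w d t' ∧ ∀ s, ∑ i, t' s i = d s := by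
  classical
  induction hn : (mixedColumns P t).ncard using Nat.strong_induction_on generalizing t with
  | _ n ih =>
    by_cases hfull : ∀ s, d s ≤ ∑ i, t s i + P * #{i | t s i = 0}
    · choose y hle hleP hmod hsum using fun s =>
        exists_le_sum_eq_of_sum_le (h.le s) (h.sum_le s) (h.sum_modEq s) (hfull s)
      refine ⟨y, ⟨hleP, fun s => (hsum s).le, fun s => by rw [hsum], fun i => ?_, fun i => ?_⟩,
        hsum⟩
      · exact (Nat.ModEq.sum fun s _ => (hmod s i).mul_left _).trans (h.weighted i)
      · exact (h.pos i).imp fun s hs => hs.trans_le (hle s i)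
    -- Some row cannot be filled: by congruence it misses its degree by at least `P` even when all
    -- its zeros are filled, so it has two entries strictly between `0` and `P`.
    push Not at hfull
    obtain ⟨s₀, hs₀⟩ := hfull
    have hroom : ∑ i, t s₀ i + P * #{i | t s₀ i = 0} + P ≤ d s₀ :=
      Nat.ModEq.add_le_of_lt (Nat.ModEq.trans (by simp [Nat.ModEq]) (h.sum_modEq s₀)) hs₀
    obtain ⟨i, j, hij, hi, hj⟩ := exists_ne_of_sum_add_le hP (hroom.trans (hd s₀))
    have hlt := Set.ncard_lt_ncard
      (mixedColumns_mergeColumns_ssubset (P := P) ⟨s₀, hi⟩ ⟨s₀, hj⟩ s₀)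
    exact ih _ (hn ▸ hlt) (h.mergeColumns hP hij (by omega)) rfl

end RowSystem

section Feasible

theorem sum_residue_fiber_mul_modEq {ι α : Type*} [Fintype ι] [Fintype α] [DecidableEq α]
    (P : ℕ) (g : ι → α) (w : ι → ℕ) (φ : α → ℕ) :
    ∑ x, residue P (∑ s with g s = x, w s) * φ x ≡ ∑ s, w s * φ (g s) [MOD P] :=
  calc ∑ x, residue P (∑ s with g s = x, w s) * φ x
      ≡ ∑ x, (∑ s with g s = x, w s) * φ x [MOD P] :=
        Nat.ModEq.sum fun x _ => (residue_modEq P _).mul_right _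
    _ = ∑ x, ∑ s with g s = x, w s * φ (g s) :=
        sum_congr rfl fun x _ => by
          rw [sum_mul]
          exact sum_congr rfl fun s hs => by rw [(mem_filter.1 hs).2]
    _ = ∑ s, w s * φ (g s) := sum_fiberwise univ g _

theorem sum_subtype_pos {ι : Type*} [Fintype ι] {w φ : ι → ℕ} (hφ : ∀ s, w s = 0 → φ s = 0) :
    ∑ s : {s // 0 < w s}, φ s = ∑ s, φ s := by
  rw [← sum_filter_of_ne (p := fun s => 0 < w s) (s := univ) (f := φ)
    fun s _ hs => Nat.pos_of_ne_zero fun h => hs (hφ s h)]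
  exact (sum_subtype _ (by simp) φ).symm

variable {p n q m k : ℕ} {D : Finset ℕ} {ι : Type*} [Fintype ι]

theorem exists_feasible_of_exponents (hp : 1 < p) (hn : 0 < n) (hQ : q ^ m = p ^ n)
    (g : ι → exponentSet (q ^ m) k D) (w : ι → ℕ) (hsum : ∑ s, w s ≡ 0 [MOD q - 1])
    (hcol : ∀ i, ∑ s, w s * (g s).1 i ≡ 0 [MOD q ^ m - 1])
    (hpos : ∀ i, ∃ s, 0 < w s ∧ 0 < (g s).1 i) :
    ∃ r, Feasible q m k D r ∧ ∑ x, digitSum p (r x) ≤ ∑ s, digitSum p (w s) := by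
  classical
  have hP : 0 < q ^ m - 1 := by
    have := Nat.one_lt_pow hn.ne' hp
    omega
  have hdvd : q - 1 ∣ q ^ m - 1 := Nat.sub_one_dvd_pow_sub_one q m
  have hmod := sum_residue_fiber_mul_modEq (q ^ m - 1) g w
  refine ⟨fun x => residue (q ^ m - 1) (∑ s with g s = x, w s),
    ⟨fun x => residue_le hP _, ?_, fun i => ?_, fun i => ?_⟩, ?_⟩
  · simpa using ((hmod fun _ => 1).of_dvd hdvd).trans (by simpa using hsum)
  · obtain ⟨s, hw, hs⟩ := hpos i
    have hfiber : 0 < ∑ s' with g s' = g s, w s' :=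
      sum_pos' (fun _ _ => Nat.zero_le _) ⟨s, by simp, hw⟩
    exact sum_pos' (fun _ _ => Nat.zero_le _)
      ⟨g s, mem_univ _, Nat.mul_pos (residue_pos hfiber) hs⟩
  · exact Nat.modEq_zero_iff_dvd.1 ((hmod fun x => x.1 i).trans (hcol i))
  · calc ∑ x, digitSum p (residue (q ^ m - 1) (∑ s with g s = x, w s))
        ≤ ∑ x, ∑ s with g s = x, digitSum p (w s) :=
          sum_le_sum fun x _ => (hQ ▸ digitSum_residue_le hp hn _).trans (digitSum_sum_le hp _ _)
      _ = ∑ s, digitSum p (w s) := sum_fiberwise univ g _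

theorem exists_feasible_of_pos (hp : 1 < p) (hn : 0 < n) (hQ : q ^ m = p ^ n)
    (hD : D ⊆ Icc 0 (k * (q ^ m - 1))) (w : ι → ℕ) (t : ι → Fin k → ℕ) (ht : ∀ s, ∑ i, t s i ∈ D)
    (hw : ∀ s, 0 < w s) (hsum : ∑ s, w s ≡ 0 [MOD q - 1])
    (hcol : ∀ i, ∑ s, w s * t s i ≡ 0 [MOD q ^ m - 1]) (hpos : ∀ i, ∃ s, 0 < t s i) :
    ∃ r, Feasible q m k D r ∧ ∑ x, digitSum p (r x) ≤ ∑ s, digitSum p (w s) := by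
  have hP : 0 < q ^ m - 1 := by
    have := Nat.one_lt_pow hn.ne' hp
    omega
  have hreduced : RowSystem (q ^ m - 1) w (fun s => ∑ i, t s i)
      fun s i => residue (q ^ m - 1) (t s i) :=
    { le := fun s i => residue_le hP _
      sum_le := fun s => sum_le_sum fun i _ => residue_le_self _ _
      sum_modEq := fun s => Nat.ModEq.sum fun i _ => residue_modEq _ _
      weighted := fun i =>
        (Nat.ModEq.sum fun s _ => (residue_modEq _ _).mul_left _).trans (hcol i)
      pos := fun i => (hpos i).imp fun s => residue_pos }
  obtain ⟨t', ht', hdeg⟩ := hreduced.exists_sum_eq hP fun s => by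
    simpa using (mem_Icc.1 (hD (ht s))).2
  have hmem : ∀ s, t' s ∈ exponentSet (q ^ m) k D := fun s => by
    rw [exponentSet, mem_filter, Fintype.mem_piFinset, hdeg]
    exact ⟨fun i => mem_Icc.2 ⟨Nat.zero_le _, ht'.le s i⟩, ht s⟩
  exact exists_feasible_of_exponents hp hn hQ (fun s => ⟨t' s, hmem s⟩) w hsum ht'.weighted
    fun i => (ht'.pos i).imp fun s hs => ⟨hw s, hs⟩

theorem exists_feasible_of_exists_pos (hp : 1 < p) (hn : 0 < n) (hQ : q ^ m = p ^ n)
    (hD : D ⊆ Icc 0 (k * (q ^ m - 1))) (w : ι → ℕ) (t : ι → Fin k → ℕ) (ht : ∀ s, ∑ i, t s i ∈ D)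
    (hsum : ∑ s, w s ≡ 0 [MOD q - 1]) (hcol : ∀ i, ∑ s, w s * t s i ≡ 0 [MOD q ^ m - 1])
    (hpos : ∀ i, ∃ s, 0 < w s ∧ 0 < t s i) :
    ∃ r, Feasible q m k D r ∧ ∑ x, digitSum p (r x) ≤ ∑ s, digitSum p (w s) := by
  rw [← sum_subtype_pos (w := w) fun s hs => (congrArg (digitSum p) hs).trans (digitSum_zero p)]
  refine exists_feasible_of_pos hp hn hQ hD (fun s : {s // 0 < w s} => w s) (fun s => t s)
    (fun s => ht s) (fun s => s.2) ?_ (fun i => ?_) fun i => ?_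
  · rwa [sum_subtype_pos (φ := w) fun _ h => h]
  · rw [sum_subtype_pos (φ := fun s => w s * t s i) fun s hs => by rw [hs, zero_mul]]
    exact hcol i
  · obtain ⟨s, hw, hs⟩ := hpos i
    exact ⟨⟨s, hw⟩, hs⟩

theorem exists_feasible_of_modEq (hp : 1 < p) (hn : 0 < n) (hQ : q ^ m = p ^ n)
    (hD : D ⊆ Icc 0 (k * (q ^ m - 1))) (hDpos : ∃ d ∈ D, 0 < d) (w : ι → ℕ) (t : ι → Fin k → ℕ)
    (ht : ∀ s, ∑ i, t s i ∈ D) (hsum : ∑ s, w s ≡ 0 [MOD q - 1])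
    (hcol : ∀ i, ∑ s, w s * t s i ≡ 0 [MOD q ^ m - 1]) :
    ∃ r, Feasible q m k D r ∧ ∑ x, digitSum p (r x) ≤
      ∑ s, digitSum p (w s) + #{i | ∑ s, w s * t s i = 0} * (n * (p - 1)) := by
  obtain ⟨d, hdD, hd⟩ := hDpos
  have hP : 0 < q ^ m - 1 := by
    have := Nat.one_lt_pow hn.ne' hp
    omega
  have hdvd : q - 1 ∣ q ^ m - 1 := Nat.sub_one_dvd_pow_sub_one q m
  -- Each vanishing column receives a new row supported on it, of weight `q ^ m - 1`.
  refine (exists_feasible_of_exists_pos hp hn hQ hD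
    (ι := ι ⊕ {i // ∑ s, w s * t s i = 0}) (Sum.elim w fun _ => q ^ m - 1)
    (Sum.elim t fun i => Pi.single i.1 d) ?_ ?_ (fun i => ?_) fun i => ?_).imp
    fun r hr => ⟨hr.1, hr.2.trans_eq ?_⟩
  · rintro (s | i)
    · exact ht s
    · simpa using hdD
  · simp only [Fintype.sum_sum_type, Sum.elim_inl, Sum.elim_inr, sum_const, smul_eq_mul]
    exact hsum.add (Nat.modEq_zero_iff_dvd.2 (hdvd.mul_left _))
  · simp only [Fintype.sum_sum_type, Sum.elim_inl, Sum.elim_inr, ← mul_sum]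
    exact (hcol i).add (Nat.modEq_zero_iff_dvd.2 (dvd_mul_right (q ^ m - 1) _))
  · by_cases hi : ∑ s, w s * t s i = 0
    · exact ⟨Sum.inr ⟨i, hi⟩, hP, by simpa using hd⟩
    · obtain ⟨s, -, hs⟩ := exists_ne_zero_of_sum_ne_zero hi
      exact ⟨Sum.inl s, Nat.pos_of_ne_zero (left_ne_zero_of_mul hs),
        Nat.pos_of_ne_zero (right_ne_zero_of_mul hs)⟩
  · simp only [Fintype.sum_sum_type, Sum.elim_inl, Sum.elim_inr, sum_const, smul_eq_mul, hQ,
      digitSum_pow_sub_one hp, card_univ, Fintype.card_subtype]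

end Feasible

section WittValuation

/-- A valuation on a field that receives the Witt vectors of `F`, integral on them and with
`p` in its maximal ideal. -/
structure IsWittValuation {p : ℕ} [Fact p.Prime] {F : Type*} [Field F] {L : Type*} [Field L]
    {Γ₀ : Type*} [LinearOrderedCommGroupWithZero Γ₀] (v : Valuation L Γ₀)
    (j : WittVector p F →+* L) : Prop where
  le_one : ∀ w, v (j w) ≤ 1
  natCast_lt_one : v (p : L) < 1

theorem exists_valuationSubring_of_not_isUnit {R L : Type*} [CommRing R] [Field L] {j : R →+* L}
    (hj : Function.Injective j) {a : R} (ha : ¬IsUnit a) :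
    ∃ V : ValuationSubring L, (∀ w, V.valuation (j w) ≤ 1) ∧ V.valuation (j a) < 1 := by
  let e : R ≃+* j.range := RingEquiv.ofBijective j.rangeRestrict
    ⟨fun x y h => hj (congrArg Subtype.val h), j.rangeRestrict_surjective⟩
  have hI : Ideal.span {e a} ≠ ⊤ := fun h =>
    ha ((MulEquiv.isUnit_map e).1 (Ideal.span_singleton_eq_top.1 h))
  obtain ⟨V, hV, hV_nonunit⟩ := Ideal.image_subset_nonunits_valuationSubring _ hI
  refine ⟨V, fun w => (V.valuation_le_one_iff _).2 (hV ⟨w, rfl⟩), ?_⟩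
  exact (V.mem_nonunits_iff).1 (hV_nonunit ⟨e a, Ideal.subset_span rfl, rfl⟩)

theorem exists_isWittValuation.{u} (p : ℕ) [Fact p.Prime] (F : Type u) [Field F] [CharP F p] :
    ∃ (L : Type u) (_ : Field L) (Γ₀ : Type u) (_ : LinearOrderedCommGroupWithZero Γ₀)
      (v : Valuation L Γ₀) (j : WittVector p F →+* L) (ζ : L),
      IsWittValuation v j ∧ IsPrimitiveRoot ζ p := by
  let K := FractionRing (WittVector p F)
  let L := AlgebraicClosure K
  let j : WittVector p F →+* L := (algebraMap K L).comp (algebraMap _ K)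
  have hj : Function.Injective j :=
    (algebraMap K L).injective.comp (IsFractionRing.injective (WittVector p F) K)
  have hp := WittVector.irreducible p (k := F)
  have hp_ne_zero : (p : L) ≠ 0 := by
    simpa only [map_natCast] using (map_ne_zero_iff j hj).2 hp.ne_zero
  obtain ⟨V, hV, hV_lt⟩ := exists_valuationSubring_of_not_isUnit hj hp.not_isUnit
  have : NeZero (p : L) := ⟨hp_ne_zero⟩
  obtain ⟨ζ, hζ⟩ := IsAlgClosed.exists_root (Polynomial.cyclotomic p L)
    (Polynomial.degree_cyclotomic_pos p L (Fact.out : p.Prime).pos).ne'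
  exact ⟨L, inferInstance, _, inferInstance, V.valuation, j, ζ,
    ⟨hV, by simpa only [map_natCast] using hV_lt⟩,
    Polynomial.isRoot_cyclotomic_iff.1 hζ⟩

/-- The Teichmüller lift, as a multiplicative character with values in a field receiving the Witt
vectors. -/
noncomputable def teich {p : ℕ} [Fact p.Prime] {F : Type*} [Field F] {L : Type*} [Field L]
    (j : WittVector p F →+* L) : MulChar F L where
  toFun z := j (WittVector.teichmuller p z)
  map_one' := by simp only [map_one]
  map_mul' := by simp only [map_mul, implies_true]
  map_nonunit' z hz := by
    rw [isUnit_iff_ne_zero, not_not] at hz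
    rw [hz, WittVector.teichmuller_zero, map_zero]

variable {p : ℕ} [Fact p.Prime] {F : Type*} [Field F] {L : Type*} [Field L]
  {Γ₀ : Type*} [LinearOrderedCommGroupWithZero Γ₀] {v : Valuation L Γ₀}
  {j : WittVector p F →+* L}

theorem teich_apply (z : F) : teich j z = j (WittVector.teichmuller p z) := rfl

theorem coeff_zero_natCast (n : ℕ) : (n : WittVector p F).coeff 0 = (n : F) :=
  map_natCast (WittVector.constantCoeff (p := p) (R := F)) n

theorem coeff_zero_sub (x y : WittVector p F) : (x - y).coeff 0 = x.coeff 0 - y.coeff 0 :=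
  map_sub (WittVector.constantCoeff (p := p) (R := F)) x y

namespace IsWittValuation

variable [CharP F p]

theorem valuation_eq_one_of_coeff_zero_ne_zero (hv : IsWittValuation v j) {w : WittVector p F}
    (hw : w.coeff 0 ≠ 0) : v (j w) = 1 := by
  obtain ⟨u, rfl⟩ := WittVector.isUnit_of_coeff_zero_ne_zero w hw
  refine le_antisymm (hv.le_one _) ?_
  calc 1 = v (j u) * v (j (↑u⁻¹ : WittVector p F)) := by
        rw [← map_mul, ← map_mul, Units.mul_inv, map_one, map_one]
    _ ≤ v (j u) := mul_le_of_le_one_right' (hv.le_one _)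

theorem valuation_natCast_eq_one (hv : IsWittValuation v j) {n : ℕ} (hn : ¬p ∣ n) :
    v (n : L) = 1 := by
  rw [← map_natCast j n]
  refine hv.valuation_eq_one_of_coeff_zero_ne_zero ?_
  rwa [coeff_zero_natCast, Ne, CharP.cast_eq_zero_iff F p]

theorem valuation_natCast_pred_eq_one (hv : IsWittValuation v j) {n : ℕ} (hn : 0 < n)
    (hpn : p ∣ n) : v ((n - 1 : ℕ) : L) = 1 := by
  refine hv.valuation_natCast_eq_one fun h => (Fact.out : p.Prime).not_dvd_one ?_
  exact (Nat.dvd_sub_iff_right hn hpn).1 h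

theorem valuation_teich_sub_teich (hv : IsWittValuation v j) {x y : F} (hxy : x ≠ y) :
    v (teich j x - teich j y) = 1 := by
  rw [teich_apply, teich_apply, ← map_sub]
  refine hv.valuation_eq_one_of_coeff_zero_ne_zero ?_
  rw [coeff_zero_sub, WittVector.teichmuller_coeff_zero, WittVector.teichmuller_coeff_zero]
  exact sub_ne_zero.2 hxy

theorem teich_injective (hv : IsWittValuation v j) : Function.Injective (teich j) := by
  intro x y h
  by_contra hxy
  have := hv.valuation_teich_sub_teich hxy
  rw [h, sub_self, map_zero] at this
  exact zero_ne_one this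

end IsWittValuation

end WittValuation

section PrimitiveRoot

variable {p : ℕ} [Fact p.Prime] {L : Type*} [Field L]
  {Γ₀ : Type*} [LinearOrderedCommGroupWithZero Γ₀] {v : Valuation L Γ₀} {ζ : L}

theorem valuation_eq_one_of_pow_eq_one {x : L} {n : ℕ} (hn : n ≠ 0) (h : x ^ n = 1) :
    v x = 1 := by
  have : v x ^ n = 1 := by rw [← map_pow, h, map_one]
  exact (pow_eq_one_iff_of_nonneg zero_le hn).1 this

theorem valuation_pow_sub_one_le {x : L} (hx : v x ≤ 1) (n : ℕ) : v (x ^ n - 1) ≤ v (x - 1) := by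
  rw [← mul_geom_sum, map_mul]
  refine mul_le_of_le_one_right' (v.map_sum_le fun i _ => ?_)
  rw [map_pow]
  exact pow_le_one₀ zero_le hx

theorem valuation_primitiveRoot_sub_one_le {μ μ' : L} (hμ : IsPrimitiveRoot μ p)
    (hμ' : IsPrimitiveRoot μ' p) : v (μ - 1) ≤ v (μ' - 1) := by
  have hp : p ≠ 0 := (Fact.out : p.Prime).ne_zero
  have : NeZero p := ⟨hp⟩
  obtain ⟨i, -, rfl⟩ := hμ'.eq_pow_of_pow_eq_one hμ.pow_eq_one
  exact valuation_pow_sub_one_le (valuation_eq_one_of_pow_eq_one hp hμ'.pow_eq_one).le i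

theorem valuation_natCast_eq_pow (hζ : IsPrimitiveRoot ζ p) : v (p : L) = v (ζ - 1) ^ (p - 1) := by
  have hfactor : (p : L) = ∏ μ ∈ primitiveRoots p L, (1 - μ) := by
    rw [← Polynomial.eval_one_cyclotomic_prime (R := L) (p := p),
      Polynomial.cyclotomic_eq_prod_X_sub_primitiveRoots hζ, Polynomial.eval_prod]
    simp only [Polynomial.eval_sub, Polynomial.eval_X, Polynomial.eval_C]
  have hvaluation : ∀ μ ∈ primitiveRoots p L, v (1 - μ) = v (ζ - 1) := fun μ hμ => by
    have hμ := isPrimitiveRoot_of_mem_primitiveRoots hμ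
    rw [v.map_sub_swap]
    exact le_antisymm (valuation_primitiveRoot_sub_one_le hμ hζ)
      (valuation_primitiveRoot_sub_one_le hζ hμ)
  rw [hfactor, map_prod, prod_congr rfl hvaluation, prod_const, hζ.card_primitiveRoots,
    Nat.totient_prime Fact.out]

theorem valuation_sub_one_pos (hζ : IsPrimitiveRoot ζ p) : 0 < v (ζ - 1) :=
  v.pos_iff.2 (sub_ne_zero.2 (hζ.ne_one (Fact.out : p.Prime).one_lt))

theorem IsWittValuation.valuation_sub_one_lt_one {F : Type*} [Field F] {j : WittVector p F →+* L}
    (hv : IsWittValuation v j) (hζ : IsPrimitiveRoot ζ p) : v (ζ - 1) < 1 := by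
  by_contra! h
  have hlt := hv.natCast_lt_one
  rw [valuation_natCast_eq_pow hζ] at hlt
  exact hlt.not_ge (one_le_pow₀ h)

end PrimitiveRoot

section PowerSums

theorem pow_eq_one_iff_of_injective {F R : Type*} [Field F] [Fintype F] [CommRing R]
    {χ : MulChar F R} (hχ : Function.Injective χ) {r : ℕ} :
    χ ^ r = 1 ↔ Fintype.card F - 1 ∣ r := by
  classical
  rw [← Fintype.card_units, ← Nat.card_eq_fintype_card, ← IsCyclic.exponent_eq_card,
    Monoid.exponent_dvd_iff_forall_pow_eq_one, MulChar.ext_iff]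
  refine forall_congr' fun z => ?_
  rw [MulChar.pow_apply_coe, MulChar.one_apply_coe, ← map_pow, ← map_one χ, hχ.eq_iff,
    ← Units.val_pow_eq_pow_val, Units.val_eq_one]

theorem sum_pow_of_injective {G R : Type*} [Group G] [Fintype G] [CommRing R] [IsDomain R]
    {φ : G →* R} (hφ : Function.Injective φ) (u : ℕ) :
    ∑ g, φ g ^ u = if Fintype.card G ∣ u then (Fintype.card G : R) else 0 := by
  classical
  have : IsCyclic G := isCyclic_of_injective_ringHom φ hφ
  have htrivial : φ ^ u = 1 ↔ Fintype.card G ∣ u := by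
    rw [← Nat.card_eq_fintype_card, ← IsCyclic.exponent_eq_card,
      Monoid.exponent_dvd_iff_forall_pow_eq_one, MonoidHom.ext_iff]
    refine forall_congr' fun g => ?_
    rw [MonoidHom.pow_apply, MonoidHom.one_apply, ← map_pow, ← map_one φ, hφ.eq_iff]
  simpa [htrivial] using sum_hom_units (φ ^ u)

theorem card_rootsOfUnity_of_dvd_card_sub_one {F : Type*} [Field F] [Fintype F] {n : ℕ}
    (hn : n ∣ Fintype.card F - 1) : Nat.card (rootsOfUnity n F) = n := by
  classical
  obtain ⟨g, hg⟩ := IsCyclic.exists_generator (α := Fˣ)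
  have horder : orderOf g = Fintype.card F - 1 := by
    rw [orderOf_eq_card_of_forall_mem_zpowers hg, Nat.card_eq_fintype_card, Fintype.card_units]
  have hpos : 0 < Fintype.card F - 1 := by
    have := Fintype.one_lt_card (α := F)
    lia
  obtain ⟨c, hc⟩ := hn
  have : NeZero n := ⟨fun h => by simp_all⟩
  have hprim : IsPrimitiveRoot (g ^ c) n :=
    (IsPrimitiveRoot.orderOf g).pow (horder ▸ hpos) (by rw [horder, hc, mul_comm])
  exact (IsPrimitiveRoot.coe_units_iff.2 hprim).card_rootsOfUnity

theorem pow_eq_self_iff_mem_rootsOfUnity {F : Type*} [Field F] {q : ℕ} (hq : 1 < q) (z : Fˣ) :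
    (z : F) ^ q = z ↔ z ∈ rootsOfUnity (q - 1) F := by
  rw [mem_rootsOfUnity, ← Units.val_pow_eq_pow_val, Units.val_inj]
  nth_rw 1 [← Nat.sub_add_cancel hq.le]
  rw [pow_succ, mul_eq_right]

theorem filter_pow_eq_self_eq_insert {F : Type*} [Field F] [Fintype F] [DecidableEq F] {q : ℕ}
    (hq : 1 < q) [Fintype (rootsOfUnity (q - 1) F)] :
    ({a : F | a ^ q = a} : Finset F) =
      insert 0 (univ.image fun g : rootsOfUnity (q - 1) F => ((g : Fˣ) : F)) := by
  ext a
  simp only [mem_filter_univ, mem_insert, mem_image, mem_univ, true_and, Subtype.exists]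
  rcases eq_or_ne a 0 with rfl | ha
  · simp only [zero_pow (by lia : q ≠ 0), true_or]
  · lift a to Fˣ using ha.isUnit
    simp only [pow_eq_self_iff_mem_rootsOfUnity hq, ha, false_or, exists_prop, Units.val_inj,
      exists_eq_right]

theorem sum_pow_filter_pow_eq_self {F R : Type*} [Field F] [Fintype F] [DecidableEq F]
    [CommRing R] [IsDomain R] {χ : MulChar F R} (hχ : Function.Injective χ) {q : ℕ} (hq : 1 < q)
    (hqF : q - 1 ∣ Fintype.card F - 1) (u : ℕ) :
    ∑ a : F with a ^ q = a, χ a ^ u =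
      if u = 0 then (q : R) else if q - 1 ∣ u then ((q - 1 : ℕ) : R) else 0 := by
  have : NeZero (q - 1) := ⟨by lia⟩
  have : Fintype (rootsOfUnity (q - 1) F) := Fintype.ofFinite _
  let φ : rootsOfUnity (q - 1) F →* R :=
    (χ : F →* R).comp ((Units.coeHom F).comp (rootsOfUnity (q - 1) F).subtype)
  have hφ : Function.Injective φ := fun x y h => Subtype.ext (Units.ext (hχ h))
  have hsum : ∑ a : F with a ^ q = a, χ a ^ u = 0 ^ u + ∑ g, φ g ^ u := by
    rw [filter_pow_eq_self_eq_insert hq, sum_insert (by simp), MulChar.map_zero,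
      sum_image fun x _ y _ h => Subtype.ext (Units.ext h)]
    rfl
  rw [hsum, sum_pow_of_injective hφ, ← Nat.card_eq_fintype_card,
    card_rootsOfUnity_of_dvd_card_sub_one hqF]
  rcases eq_or_ne u 0 with rfl | hu
  · rw [pow_zero, if_pos (dvd_zero _), if_pos rfl, Nat.cast_pred (by lia), add_sub_cancel]
  · rw [zero_pow hu, zero_add, if_neg hu]

theorem sum_pow_of_mulChar_injective {F R : Type*} [Field F] [Fintype F] [CommRing R] [IsDomain R]
    {χ : MulChar F R} (hχ : Function.Injective χ) (u : ℕ) :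
    ∑ z, χ z ^ u = if u = 0 then (Fintype.card F : R) else
      if Fintype.card F - 1 ∣ u then ((Fintype.card F - 1 : ℕ) : R) else 0 := by
  classical
  simpa [FiniteField.pow_card] using
    sum_pow_filter_pow_eq_self hχ Fintype.one_lt_card (dvd_refl (Fintype.card F - 1)) u

end PowerSums

section TraceChar

variable {p : ℕ} [Fact p.Prime] {F : Type*} [Field F] [Algebra (ZMod p) F]
  {L : Type*} [Field L] {ζ : L}

/-- The additive character `z ↦ ζ ^ Tr z`, with the trace read in `{0, …, p - 1}`. -/
noncomputable def traceChar (F : Type*) [Field F] [Algebra (ZMod p) F]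
    (hζ : IsPrimitiveRoot ζ p) : AddChar F L :=
  (AddChar.zmodChar p hζ.pow_eq_one).compAddMonoidHom (Algebra.trace (ZMod p) F).toAddMonoidHom

theorem traceChar_apply (hζ : IsPrimitiveRoot ζ p) (z : F) :
    traceChar F hζ z = ζ ^ (Algebra.trace (ZMod p) F z).val := rfl

theorem traceChar_ne_one [Finite F] (hζ : IsPrimitiveRoot ζ p) : traceChar F hζ ≠ 1 := by
  intro h
  refine Algebra.trace_ne_zero (ZMod p) F (LinearMap.ext fun z => ?_)
  have hz : traceChar F hζ z = 1 := by rw [h, AddChar.one_apply]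
  rw [traceChar_apply, hζ.pow_eq_one_iff_dvd] at hz
  exact (ZMod.val_eq_zero _).1 (Nat.eq_zero_of_dvd_of_lt hz (ZMod.val_lt _))

theorem traceChar_isPrimitive [Finite F] (hζ : IsPrimitiveRoot ζ p) :
    (traceChar F hζ).IsPrimitive :=
  AddChar.IsPrimitive.of_ne_one (traceChar_ne_one hζ)

theorem sum_inv_mul_self {K : Type*} [Field K] [Fintype K] : ∑ z : K, z⁻¹ * z = -1 := by
  classical
  have hterm (z : K) : z⁻¹ * z = 1 - if z = 0 then 1 else 0 := by
    split_ifs with hz <;> simp [hz]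
  simp only [hterm, sum_sub_distrib, sum_const, card_univ, nsmul_eq_mul, mul_one,
    FiniteField.cast_card_eq_zero, sum_ite_eq', mem_univ, if_true, zero_sub]

theorem sum_inv_mul_pow {K : Type*} [Field K] [Fintype K] {n : ℕ} (hn : 1 < n)
    (hnK : n < Fintype.card K) : ∑ z : K, z⁻¹ * z ^ n = 0 := by
  have hterm (z : K) : z⁻¹ * z ^ n = z ^ (n - 1) := by
    rcases eq_or_ne z 0 with rfl | hz
    · rw [inv_zero, zero_mul, zero_pow (by lia)]
    · rw [← mul_pow_sub_one (by lia) z, inv_mul_cancel_left₀ hz]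
  rw [sum_congr rfl fun z _ => hterm z, FiniteField.sum_pow_lt_card_sub_one _ _ (by lia)]

theorem sum_inv_mul_trace [Fintype F] :
    ∑ z : F, z⁻¹ * ((Algebra.trace (ZMod p) F z).val : F) = -1 := by
  have hp : p.Prime := Fact.out
  have hcard : Fintype.card F = p ^ Module.finrank (ZMod p) F := by
    rw [Module.card_eq_pow_finrank (K := ZMod p) (V := F), ZMod.card]
  have htrace (z : F) : ((Algebra.trace (ZMod p) F z).val : F) =
      ∑ i ∈ range (Module.finrank (ZMod p) F), z ^ p ^ i := by
    rw [← map_natCast (algebraMap (ZMod p) F), ZMod.natCast_zmod_val,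
      FiniteField.algebraMap_trace_eq_sum_pow, Nat.card_zmod]
  simp_rw [htrace, mul_sum]
  rw [sum_comm, sum_eq_single_of_mem 0 (mem_range.2 Module.finrank_pos)]
  · simp only [pow_zero, pow_one, sum_inv_mul_self]
  · intro i hi hi0
    refine sum_inv_mul_pow (Nat.one_lt_pow hi0 hp.one_lt) ?_
    rw [hcard]
    exact Nat.pow_lt_pow_right hp.one_lt (mem_range.1 hi)

theorem traceChar_pow_char [Finite F] [CharP F p] (hζ : IsPrimitiveRoot ζ p) (z : F) :
    traceChar F hζ (z ^ p) = traceChar F hζ z := by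
  have htrace := Algebra.trace_eq_of_algEquiv (FiniteField.frobeniusAlgEquiv (ZMod p) F p) z
  rw [FiniteField.frobeniusAlgEquiv_apply, ZMod.card] at htrace
  rw [traceChar_apply, traceChar_apply, htrace]

theorem traceChar_pow_char_pow [Finite F] [CharP F p] (hζ : IsPrimitiveRoot ζ p) (n : ℕ) (z : F) :
    traceChar F hζ (z ^ p ^ n) = traceChar F hζ z := by
  induction n with
  | zero => rw [pow_zero, pow_one]
  | succ n ih => rw [pow_succ, pow_mul, traceChar_pow_char, ih]

end TraceChar

section Stickelberger

variable {F : Type*} [Field F] {L : Type*} [Field L] {Γ₀ : Type*}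
  [LinearOrderedCommGroupWithZero Γ₀] {v : Valuation L Γ₀}

theorem valuation_mulChar_le_one [Finite F] (χ : MulChar F L) (z : F) : v (χ z) ≤ 1 := by
  have := Fintype.ofFinite F
  rcases eq_or_ne z 0 with rfl | hz
  · rw [MulChar.map_zero, map_zero]
    exact zero_le
  · refine (valuation_eq_one_of_pow_eq_one
      (Nat.sub_ne_zero_of_lt (Fintype.one_lt_card (α := F))) ?_).le
    rw [← map_pow, FiniteField.pow_card_sub_one_eq_one z hz, map_one]

variable [Fintype F]

theorem valuation_gaussSum_mul_gaussSum_le {χ φ : MulChar F L} (h : χ * φ ≠ 1)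
    (ψ : AddChar F L) :
    v (gaussSum χ ψ) * v (gaussSum φ ψ) ≤ v (gaussSum (χ * φ) ψ) := by
  rw [← map_mul, ← jacobiSum_mul_nontrivial h, map_mul]
  refine mul_le_of_le_one_right' (v.map_sum_le fun z _ => ?_)
  rw [map_mul]
  exact mul_le_one' (valuation_mulChar_le_one χ z) (valuation_mulChar_le_one φ _)

theorem valuation_gaussSum_inv (χ : MulChar F L) (ψ : AddChar F L) :
    v (gaussSum χ ψ⁻¹) = v (gaussSum χ ψ) := by
  have hsq : χ (-1) ^ 2 = 1 := by rw [← map_pow, neg_one_sq, map_one]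
  conv_rhs => rw [← mul_gaussSum_inv_eq_gaussSum, map_mul,
    valuation_eq_one_of_pow_eq_one two_ne_zero hsq, one_mul]

theorem gaussSum_pow_char_mul {p : ℕ} [Fact p.Prime] [CharP F p] [Algebra (ZMod p) F] {ζ : L}
    (hζ : IsPrimitiveRoot ζ p) (χ : MulChar F L) {r : ℕ} (hr : 0 < r) :
    gaussSum (χ ^ (p * r)) (traceChar F hζ) = gaussSum (χ ^ r) (traceChar F hζ) := by
  refine Fintype.sum_equiv (frobeniusEquiv F p).toEquiv _ _ fun z => ?_
  change _ = (χ ^ r) (z ^ p) * traceChar F hζ (z ^ p)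
  rw [traceChar_pow_char, MulChar.pow_apply' _ hr.ne',
    MulChar.pow_apply' _ (Nat.mul_pos (Fact.out : p.Prime).pos hr).ne', map_pow, pow_mul]

theorem valuation_pow_sub_one_sub_le {x : L} (hx : v x ≤ 1) (n : ℕ) :
    v (x ^ n - 1 - n * (x - 1)) ≤ v (x - 1) ^ 2 := by
  have hfactor : x ^ n - 1 - n * (x - 1) = (x - 1) * ∑ i ∈ range n, (x ^ i - 1) := by
    rw [sum_sub_distrib, mul_sub (x - 1), mul_geom_sum, sum_const, card_range, nsmul_one,
      mul_comm (n : L)]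
  rw [hfactor, map_mul, sq]
  gcongr
  exact v.map_sum_le fun i _ => valuation_pow_sub_one_le hx i

variable {p : ℕ} [Fact p.Prime] [CharP F p] {j : WittVector p F →+* L} {ζ : L}

namespace IsWittValuation

theorem inv_teich_pow_eq_one_iff (hv : IsWittValuation v j) {r : ℕ} :
    (teich j)⁻¹ ^ r = 1 ↔ Fintype.card F - 1 ∣ r := by
  rw [inv_pow, inv_eq_one, pow_eq_one_iff_of_injective hv.teich_injective]

variable [Algebra (ZMod p) F]

theorem valuation_sum_inv_teich_mul_trace (hv : IsWittValuation v j) :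
    v (∑ z, (teich j)⁻¹ z * (Algebra.trace (ZMod p) F z).val) = 1 := by
  have hlift : ∑ z, (teich j)⁻¹ z * (Algebra.trace (ZMod p) F z).val =
      j (∑ z, WittVector.teichmuller p z⁻¹ * (Algebra.trace (ZMod p) F z).val) := by
    simp only [map_sum, map_mul, map_natCast, MulChar.inv_apply', teich_apply]
  have hcoeff : (∑ z, WittVector.teichmuller p z⁻¹ *
      ((Algebra.trace (ZMod p) F z).val : WittVector p F)).coeff 0 = -1 := by
    rw [← WittVector.constantCoeff_apply, ← sum_inv_mul_trace (p := p) (F := F)]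
    simp only [map_sum, map_mul, map_natCast, WittVector.constantCoeff_apply,
      WittVector.teichmuller_coeff_zero]
  rw [hlift, hv.valuation_eq_one_of_coeff_zero_ne_zero (hcoeff ▸ neg_ne_zero.2 one_ne_zero)]

theorem valuation_gaussSum_inv_teich (hv : IsWittValuation v j) (hζ : IsPrimitiveRoot ζ p)
    (hF : 2 < Fintype.card F) :
    v (gaussSum (teich j)⁻¹ (traceChar F hζ)) = v (ζ - 1) := by
  let n : F → ℕ := fun z => (Algebra.trace (ZMod p) F z).val
  have hsum_zero : ∑ z, (teich j)⁻¹ z = 0 := by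
    refine MulChar.sum_eq_zero_of_ne_one fun h => ?_
    rw [← pow_one (teich j)⁻¹, hv.inv_teich_pow_eq_one_iff, Nat.dvd_one] at h
    lia
  -- Expand `ζ ^ Tr z` to first order in `ζ - 1`: the constant term sums to `0`.
  have hexpand : gaussSum (teich j)⁻¹ (traceChar F hζ) =
      (ζ - 1) * ∑ z, (teich j)⁻¹ z * n z +
        ∑ z, (teich j)⁻¹ z * (ζ ^ n z - 1 - n z * (ζ - 1)) := by
    rw [mul_sum, ← sum_add_distrib, ← sub_zero (gaussSum _ _), ← hsum_zero, gaussSum,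
      ← sum_sub_distrib]
    refine sum_congr rfl fun z _ => ?_
    rw [traceChar_apply]
    ring
  have hlinear : v ((ζ - 1) * ∑ z, (teich j)⁻¹ z * n z) = v (ζ - 1) := by
    rw [map_mul, hv.valuation_sum_inv_teich_mul_trace, mul_one]
  have hζ_le : v ζ ≤ 1 :=
    (valuation_eq_one_of_pow_eq_one (Fact.out : p.Prime).ne_zero hζ.pow_eq_one).le
  have hremainder :
      v (∑ z, (teich j)⁻¹ z * (ζ ^ n z - 1 - n z * (ζ - 1))) ≤ v (ζ - 1) ^ 2 := by
    refine v.map_sum_le fun z _ => ?_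
    rw [map_mul]
    exact (mul_le_of_le_one_left' (valuation_mulChar_le_one _ z)).trans
      (valuation_pow_sub_one_sub_le hζ_le _)
  rw [hexpand, v.map_add_eq_of_lt_left, hlinear]
  rw [hlinear]
  exact hremainder.trans_lt
    (pow_lt_self_of_lt_one₀ (valuation_sub_one_pos hζ) (hv.valuation_sub_one_lt_one hζ) one_lt_two)

theorem pow_digitSum_le_valuation_gaussSum (hv : IsWittValuation v j) (hζ : IsPrimitiveRoot ζ p)
    (r : ℕ) (hr : 0 < r) (hrF : r < Fintype.card F - 1) :
    v (ζ - 1) ^ digitSum p r ≤ v (gaussSum ((teich j)⁻¹ ^ r) (traceChar F hζ)) := by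
  have hp : p.Prime := Fact.out
  induction r using Nat.strong_induction_on with
  | _ r ih =>
  by_cases hdvd : p ∣ r
  · obtain ⟨s, rfl⟩ := hdvd
    have hs : 0 < s := Nat.pos_of_mul_pos_left hr
    have hlt : s < p * s := lt_mul_of_one_lt_left hs hp.one_lt
    rw [gaussSum_pow_char_mul hζ _ hs, digitSum_mul_left hp.one_lt]
    exact ih s hlt hs (hlt.trans hrF)
  obtain ⟨s, rfl⟩ : ∃ s, r = s + 1 := Nat.exists_eq_add_one.2 hr
  rw [digitSum_add_one_of_not_dvd hp.one_lt hdvd, pow_succ]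
  rcases Nat.eq_zero_or_pos s with rfl | hs
  · rw [digitSum_zero, pow_zero, one_mul, zero_add, pow_one,
      hv.valuation_gaussSum_inv_teich hζ (by lia)]
  · calc v (ζ - 1) ^ digitSum p s * v (ζ - 1)
        ≤ v (gaussSum ((teich j)⁻¹ ^ s) (traceChar F hζ)) *
            v (gaussSum (teich j)⁻¹ (traceChar F hζ)) := by
          rw [hv.valuation_gaussSum_inv_teich hζ (by lia)]
          gcongr
          exact ih s (by lia) hs (by lia)
      _ ≤ v (gaussSum ((teich j)⁻¹ ^ (s + 1)) (traceChar F hζ)) := by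
          rw [pow_succ]
          refine valuation_gaussSum_mul_gaussSum_le ?_ _
          rw [← pow_succ, Ne, hv.inv_teich_pow_eq_one_iff]
          exact Nat.not_dvd_of_pos_of_lt hr hrF

theorem valuation_gaussSum_mul_gaussSum_eq (hv : IsWittValuation v j) (hζ : IsPrimitiveRoot ζ p)
    {r s : ℕ} (hr : 0 < r) (hrF : r < Fintype.card F - 1) (hrs : r + s = Fintype.card F - 1) :
    v (gaussSum ((teich j)⁻¹ ^ r) (traceChar F hζ)) *
      v (gaussSum ((teich j)⁻¹ ^ s) (traceChar F hζ)) = v (Fintype.card F : L) := by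
  have hne : (teich j)⁻¹ ^ r ≠ 1 := by
    rw [Ne, hv.inv_teich_pow_eq_one_iff]
    exact Nat.not_dvd_of_pos_of_lt hr hrF
  have hinv : ((teich j)⁻¹ ^ r)⁻¹ = (teich j)⁻¹ ^ s := by
    rw [inv_eq_iff_mul_eq_one, ← pow_add, hv.inv_teich_pow_eq_one_iff, hrs]
  rw [← gaussSum_mul_gaussSum_eq_card hne (traceChar_isPrimitive hζ), map_mul,
    valuation_gaussSum_inv, hinv]

theorem valuation_gaussSum_inv_teich_pow (hv : IsWittValuation v j) (hζ : IsPrimitiveRoot ζ p)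
    {n : ℕ} (hF : Fintype.card F = p ^ n) {r : ℕ} (hr : 0 < r) (hrF : r < Fintype.card F - 1) :
    v (gaussSum ((teich j)⁻¹ ^ r) (traceChar F hζ)) = v (ζ - 1) ^ digitSum p r := by
  obtain ⟨s, hrs⟩ : ∃ s, r + s = Fintype.card F - 1 := ⟨_, Nat.add_sub_of_le hrF.le⟩
  have hle_r := hv.pow_digitSum_le_valuation_gaussSum hζ r hr hrF
  have hle_s := hv.pow_digitSum_le_valuation_gaussSum hζ s (by lia) (by lia)
  have hpos : 0 < v (ζ - 1) ^ digitSum p s := pow_pos (valuation_sub_one_pos hζ) _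
  have hcard : v (Fintype.card F : L) = v (ζ - 1) ^ digitSum p r * v (ζ - 1) ^ digitSum p s := by
    have hs : s = p ^ n - 1 - r := by lia
    rw [← pow_add, hs, digitSum_add_digitSum_compl (Fact.out : p.Prime).one_lt (by lia), hF,
      Nat.cast_pow, map_pow, valuation_natCast_eq_pow hζ, ← pow_mul, mul_comm]
  have hmul := (hv.valuation_gaussSum_mul_gaussSum_eq hζ hr hrF hrs).trans hcard
  refine hle_r.antisymm' ?_
  by_contra! hlt
  exact (mul_lt_mul hlt hle_s hpos zero_le).ne hmul.symm

end IsWittValuation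

end Stickelberger

section Interpolation

variable {α L : Type*} [Fintype α] [Field L]

theorem sum_interpolate_coeff_mul_pow [DecidableEq α] {x : α → L} (hx : Function.Injective x)
    {s : ℕ} (hs : s < Fintype.card α) (r : ℕ) :
    ∑ a, (Lagrange.basis univ x a).coeff r * x a ^ s = if r = s then 1 else 0 := by
  have hX : Lagrange.interpolate univ x (fun a => x a ^ s) = Polynomial.X ^ s := by
    refine (Lagrange.eq_interpolate_of_eval_eq _ hx.injOn ?_ fun a _ => ?_).symm
    · rw [Polynomial.degree_X_pow, card_univ]
      exact_mod_cast hs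
    · rw [Polynomial.eval_pow, Polynomial.eval_X]
  rw [← Polynomial.coeff_X_pow, ← hX, Lagrange.interpolate_apply, Polynomial.finsetSum_coeff]
  exact sum_congr rfl fun a _ => by rw [Polynomial.coeff_C_mul, mul_comm]

variable {Γ₀ : Type*} [LinearOrderedCommGroupWithZero Γ₀] {v : Valuation L Γ₀}

theorem valuation_basis_coeff_le_one [DecidableEq α] {x : α → L}
    (hx : ∀ a, v (x a) ≤ 1) (hxx : ∀ a b, a ≠ b → v (x a - x b) = 1) (a : α) (r : ℕ) :
    v ((Lagrange.basis univ x a).coeff r) ≤ 1 := by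
  suffices Lagrange.basis univ x a ∈ Polynomial.liftsRing v.integer.subtype by
    rw [← Polynomial.lifts_iff_liftsRing, Polynomial.lifts_iff_coeff_lifts] at this
    obtain ⟨y, hy⟩ := this r
    exact hy ▸ y.2
  have hC {y : L} (hy : v y ≤ 1) : Polynomial.C y ∈ Polynomial.liftsRing v.integer.subtype :=
    (Polynomial.lifts_iff_liftsRing _ _).1 (Polynomial.C'_mem_lifts ⟨⟨y, hy⟩, rfl⟩)
  refine prod_mem fun b hb => mul_mem (hC ?_) (sub_mem ?_ (hC (hx b)))
  · rw [map_inv₀, hxx a b (ne_of_mem_erase hb).symm, inv_one]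
  · exact (Polynomial.lifts_iff_liftsRing _ _).1 (Polynomial.X_mem_lifts _)

theorem sum_prod_basis_coeff_mul_prod_pow [DecidableEq α] {ι : Type*} [Fintype ι]
    [DecidableEq ι] {x : α → L} (hx : Function.Injective x) (r : ι → ℕ) {s : ι → ℕ}
    (hs : ∀ i, s i < Fintype.card α) :
    ∑ c : ι → α, (∏ i, (Lagrange.basis univ x (c i)).coeff (r i)) * ∏ i, x (c i) ^ s i =
      if r = s then 1 else 0 := by
  simp_rw [← prod_mul_distrib]
  rw [← Fintype.piFinset_univ,
    ← prod_univ_sum (fun _ => univ) fun i a => (Lagrange.basis univ x a).coeff (r i) * x a ^ s i]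
  simp_rw [sum_interpolate_coeff_mul_pow hx (hs _), prod_ite_zero, funext_iff, prod_const_one,
    mem_univ, true_implies]

theorem exists_valuation_coeff_le_valuation_eval [Nonempty α] {ι : Type*} [Fintype ι]
    [DecidableEq ι] {x : α → L} (hx : ∀ a, v (x a) ≤ 1)
    (hxx : ∀ a b, a ≠ b → v (x a - x b) = 1) (E : (ι → ℕ) → L) {r₀ : ι → ℕ}
    (hr₀ : ∀ i, r₀ i < Fintype.card α) :
    ∃ c : ι → α, v (E r₀) ≤
      v (∑ r ∈ Fintype.piFinset fun _ => range (Fintype.card α), E r * ∏ i, x (c i) ^ r i) := by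
  classical
  have hinj : Function.Injective x := fun a b h => by
    by_contra hab
    simpa only [h, sub_self, map_zero, zero_ne_one] using hxx a b hab
  let P : (ι → α) → L := fun c =>
    ∑ r ∈ Fintype.piFinset fun _ => range (Fintype.card α), E r * ∏ i, x (c i) ^ r i
  have hE : E r₀ = ∑ c, (∏ i, (Lagrange.basis univ x (c i)).coeff (r₀ i)) * P c := by
    simp_rw [P, mul_sum, mul_left_comm _ (E _)]
    rw [sum_comm]
    simp_rw [← mul_sum]
    rw [sum_congr rfl fun r hr => by
      rw [sum_prod_basis_coeff_mul_prod_pow hinj r₀ fun i =>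
        mem_range.1 (Fintype.mem_piFinset.1 hr i)]]
    simp only [mul_ite, mul_one, mul_zero, sum_ite_eq, Fintype.mem_piFinset, mem_range, hr₀,
      implies_true, if_true]
  by_contra! hlt
  have hpos : 0 < v (E r₀) := zero_le.trans_lt (hlt fun _ => Classical.arbitrary α)
  refine (v.map_sum_lt' hpos fun c _ => ?_).ne (congrArg v hE).symm
  rw [map_mul, map_prod]
  exact (mul_le_of_le_one_left' (prod_le_one' fun i _ =>
    valuation_basis_coeff_le_one hx hxx _ _)).trans_lt (hlt c)

end Interpolation

section TraceCoeff

theorem sum_pow_mul_sum_range {F R : Type*} [Field F] [Fintype F] [CommRing R] [IsDomain R]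
    {χ : MulChar F R} (hχ : Function.Injective χ) (c : ℕ → R) {r : ℕ} (hr : 0 < r)
    (hrF : r < Fintype.card F - 1) :
    ∑ z, χ z ^ (Fintype.card F - 1 - r) * ∑ s ∈ range (Fintype.card F), c s * χ z ^ s =
      ((Fintype.card F - 1 : ℕ) : R) * c r := by
  simp_rw [mul_sum, mul_left_comm _ (c _), ← pow_add]
  rw [sum_comm]
  simp_rw [← mul_sum, sum_pow_of_mulChar_injective hχ]
  rw [sum_eq_single_of_mem r (mem_range.2 (by lia)), Nat.sub_add_cancel hrF.le, if_neg (by lia),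
    if_pos dvd_rfl, mul_comm]
  intro s hs hsr
  rw [mem_range] at hs
  rw [if_neg (by lia), if_neg, mul_zero]
  rintro ⟨d, hd⟩
  rcases d with _ | _ | d
  · lia
  · lia
  · have : (Fintype.card F - 1) * 2 ≤ (Fintype.card F - 1) * (d + 1 + 1) :=
      Nat.mul_le_mul_left _ (by lia)
    lia

theorem sum_sum_range_mul_pow {F R : Type*} [Field F] [Fintype F] [CommRing R] [IsDomain R]
    {χ : MulChar F R} (hχ : Function.Injective χ) (c : ℕ → R) :
    ∑ z, ∑ s ∈ range (Fintype.card F), c s * χ z ^ s =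
      Fintype.card F * c 0 + ((Fintype.card F - 1 : ℕ) : R) * c (Fintype.card F - 1) := by
  have hF : 1 < Fintype.card F := Fintype.one_lt_card
  rw [sum_comm]
  simp_rw [← mul_sum, sum_pow_of_mulChar_injective hχ]
  rw [← sum_subset (s₁ := {0, Fintype.card F - 1}) (by grind), sum_pair (by lia), if_pos rfl,
    if_neg (by lia), if_pos dvd_rfl, mul_comm, mul_comm (c _)]
  intro s hs hs'
  simp only [mem_range, mem_insert, mem_singleton, not_or] at hs hs'
  rw [if_neg hs'.1, if_neg fun h => hs'.2 ?_, mul_zero]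
  exact (Nat.le_of_dvd (Nat.pos_of_ne_zero hs'.1) h).antisymm' (by lia)

theorem addChar_sum_eq_prod {A M ι : Type*} [AddCommGroup A] [CommMonoid M] (ψ : AddChar A M)
    (s : Finset ι) (f : ι → A) : ψ (∑ i ∈ s, f i) = ∏ i ∈ s, ψ (f i) :=
  map_prod ψ.toMonoidHom (fun i => Multiplicative.ofAdd (f i)) s

variable {p : ℕ} [Fact p.Prime] {F : Type*} [Field F] [Fintype F] [CharP F p]
  [Algebra (ZMod p) F] {L : Type*} [Field L] {Γ₀ : Type*} [LinearOrderedCommGroupWithZero Γ₀]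
  {v : Valuation L Γ₀} {j : WittVector p F →+* L} {ζ : L}

open Classical in
/-- The coefficients of the additive character in its expansion in powers of the Teichmüller
character. -/
noncomputable def traceCoeff (j : WittVector p F →+* L) (hζ : IsPrimitiveRoot ζ p) (r : ℕ) : L :=
  (Lagrange.interpolate univ (teich j) (traceChar F hζ)).coeff r

namespace IsWittValuation

theorem traceChar_eq_sum_range (hv : IsWittValuation v j) (hζ : IsPrimitiveRoot ζ p) (z : F) :
    traceChar F hζ z = ∑ r ∈ range (Fintype.card F), traceCoeff j hζ r * teich j z ^ r := by
  classical
  have hinj : Set.InjOn (teich j) (univ : Finset F) := hv.teich_injective.injOn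
  rw [← Lagrange.eval_interpolate_at_node (traceChar F hζ) hinj (mem_univ z)]
  refine Polynomial.eval_eq_sum_range' ?_ _
  rw [Nat.lt_iff_le_pred Fintype.card_pos]
  refine Polynomial.natDegree_le_of_degree_le ?_
  exact Lagrange.degree_interpolate_le (traceChar F hζ) hinj

theorem traceChar_mul_sum_monomial (hv : IsWittValuation v j) (hζ : IsPrimitiveRoot ζ p)
    {ι : Type*} [Fintype ι] [DecidableEq ι] {k : ℕ} (c : ι → F) (t : ι → Fin k → ℕ) (a : F)
    (x : Fin k → F) : traceChar F hζ (a * ∑ s, c s * ∏ i, x i ^ t s i) =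
      ∑ r ∈ Fintype.piFinset fun _ => range (Fintype.card F),
        (∏ s, traceCoeff j hζ (r s)) * (∏ s, teich j (c s) ^ r s) * teich j a ^ (∑ s, r s) *
          ∏ i, teich j (x i) ^ ∑ s, r s * t s i := by
  rw [mul_sum, addChar_sum_eq_prod]
  simp_rw [hv.traceChar_eq_sum_range hζ]
  rw [prod_univ_sum]
  refine sum_congr rfl fun r _ => ?_
  simp_rw [← prod_pow_eq_pow_sum]
  rw [prod_comm, ← prod_mul_distrib, ← prod_mul_distrib, ← prod_mul_distrib]
  refine prod_congr rfl fun s _ => ?_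
  simp_rw [map_mul, map_prod, map_pow, mul_pow, ← prod_pow, ← pow_mul, mul_comm (t s _)]
  ring

theorem traceCoeff_zero (hv : IsWittValuation v j) (hζ : IsPrimitiveRoot ζ p) :
    traceCoeff j hζ (0 : ℕ) = 1 := by
  have h := hv.traceChar_eq_sum_range hζ (0 : F)
  rw [AddChar.map_zero_eq_one, MulChar.map_zero,
    sum_eq_single_of_mem 0 (mem_range.2 Fintype.card_pos)
      fun r _ hr => by rw [zero_pow hr, mul_zero], pow_zero, mul_one] at h
  exact h.symm

theorem gaussSum_eq_mul_traceCoeff (hv : IsWittValuation v j) (hζ : IsPrimitiveRoot ζ p) {r : ℕ}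
    (hr : 0 < r) (hrF : r < Fintype.card F - 1) :
    gaussSum ((teich j)⁻¹ ^ r) (traceChar F hζ) =
      ((Fintype.card F - 1 : ℕ) : L) * traceCoeff j hζ r := by
  have hinv : (teich j)⁻¹ ^ r = teich j ^ (Fintype.card F - 1 - r) := by
    rw [inv_pow, inv_eq_iff_mul_eq_one, ← pow_add, Nat.add_sub_of_le hrF.le,
      pow_eq_one_iff_of_injective hv.teich_injective]
  rw [← sum_pow_mul_sum_range hv.teich_injective _ hr hrF, hinv]
  refine sum_congr rfl fun z _ => ?_
  rw [MulChar.pow_apply' _ (by lia), ← hv.traceChar_eq_sum_range hζ]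

theorem card_sub_one_mul_traceCoeff (hv : IsWittValuation v j) (hζ : IsPrimitiveRoot ζ p) :
    ((Fintype.card F - 1 : ℕ) : L) * traceCoeff j hζ (Fintype.card F - 1) =
      -(Fintype.card F : L) := by
  have hsum := AddChar.sum_eq_zero_of_ne_one (traceChar_ne_one (F := F) hζ)
  simp_rw [hv.traceChar_eq_sum_range hζ] at hsum
  rw [sum_sum_range_mul_pow hv.teich_injective, hv.traceCoeff_zero hζ, mul_one] at hsum
  exact eq_neg_of_add_eq_zero_right hsum

theorem valuation_traceCoeff (hv : IsWittValuation v j) (hζ : IsPrimitiveRoot ζ p) {n : ℕ}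
    (hF : Fintype.card F = p ^ n) {r : ℕ} (hr : r < Fintype.card F) :
    v (traceCoeff j hζ r) = v (ζ - 1) ^ digitSum p r := by
  have hp : p.Prime := Fact.out
  have hunit : v ((Fintype.card F - 1 : ℕ) : L) = 1 :=
    hv.valuation_natCast_pred_eq_one Fintype.card_pos ((CharP.cast_eq_zero_iff F p _).1
      (FiniteField.cast_card_eq_zero F))
  rcases Nat.eq_zero_or_pos r with rfl | hr_pos
  · rw [hv.traceCoeff_zero, map_one, digitSum_zero, pow_zero]
  rcases (Nat.le_sub_one_of_lt hr).lt_or_eq with hrF | rfl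
  · rw [← hv.valuation_gaussSum_inv_teich_pow hζ hF hr_pos hrF,
      hv.gaussSum_eq_mul_traceCoeff hζ hr_pos hrF, map_mul, hunit, one_mul]
  · rw [← one_mul (v (traceCoeff _ _ _)), ← hunit, ← map_mul, hv.card_sub_one_mul_traceCoeff hζ,
      v.map_neg, hF, digitSum_pow_sub_one hp.one_lt, Nat.cast_pow, map_pow,
      valuation_natCast_eq_pow hζ, ← pow_mul, mul_comm]

end IsWittValuation

end TraceCoeff

section Counting

theorem natCast_card_ne_zero {p : ℕ} [Fact p.Prime] {F : Type*} [Field F] [Fintype F] [CharP F p]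
    {L : Type*} [Field L] {ζ : L} (hζ : IsPrimitiveRoot ζ p) : (Fintype.card F : L) ≠ 0 := by
  have : NeZero p := ⟨(Fact.out : p.Prime).ne_zero⟩
  obtain ⟨n, -, hn⟩ := FiniteField.card F p
  rw [hn, Nat.cast_pow]
  exact pow_ne_zero _ hζ.neZero'.out

variable {p : ℕ} [Fact p.Prime] {F : Type*} [Field F] [Fintype F] [DecidableEq F] [CharP F p]
  [Algebra (ZMod p) F] {L : Type*} [Field L] {ζ : L}

theorem sum_traceChar_mul_sub_pow (hζ : IsPrimitiveRoot ζ p) (e : ℕ) (a : F) :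
    ∑ y, traceChar F hζ (a * (y - y ^ p ^ e)) =
      if a ^ p ^ e = a then (Fintype.card F : L) else 0 := by
  have hterm (y : F) : traceChar F hζ (a * (y - y ^ p ^ e)) =
      traceChar F hζ (iterateFrobeniusEquiv F p e y * (a ^ p ^ e - a)) := by
    rw [iterateFrobeniusEquiv_apply, iterateFrobenius_def, mul_sub, mul_sub,
      AddChar.map_sub_eq_div, AddChar.map_sub_eq_div, ← mul_pow, traceChar_pow_char_pow,
      mul_comm y a, mul_comm a (y ^ _)]
  simp_rw [hterm]
  rw [(iterateFrobeniusEquiv F p e).bijective.sum_comp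
      fun y => traceChar F hζ (y * (a ^ p ^ e - a)),
    AddChar.sum_mulShift _ (traceChar_isPrimitive hζ)]
  simp only [sub_eq_zero, Nat.cast_ite, Nat.cast_zero]

theorem card_filter_eq_pow_sub_self (hζ : IsPrimitiveRoot ζ p) (e : ℕ) (b : F) :
    (#{y | b = y ^ p ^ e - y} : L) = ∑ a with a ^ p ^ e = a, traceChar F hζ (a * b) := by
  have hcard := natCast_card_ne_zero (F := F) hζ
  have horth (y : F) : (Fintype.card F : L) * (if b = y ^ p ^ e - y then 1 else 0) =
      ∑ a, traceChar F hζ (a * (b - (y ^ p ^ e - y))) := by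
    rw [AddChar.sum_mulShift _ (traceChar_isPrimitive hζ)]
    simp only [sub_eq_zero, Nat.cast_ite, Nat.cast_zero, mul_ite, mul_one, mul_zero]
  have hsplit (a y : F) : traceChar F hζ (a * (b - (y ^ p ^ e - y))) =
      traceChar F hζ (a * b) * traceChar F hζ (a * (y - y ^ p ^ e)) := by
    rw [← AddChar.map_add_eq_mul, ← mul_add, add_sub, sub_sub_eq_add_sub]
  refine mul_left_cancel₀ hcard ?_
  rw [natCast_card_filter, mul_sum]
  simp_rw [horth, hsplit]
  rw [sum_comm, sum_filter]
  simp_rw [← mul_sum, sum_traceChar_mul_sub_pow]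
  simp_rw [mul_sum, mul_ite, mul_zero, mul_comm]

theorem numSolutions_eq_sum (hζ : IsPrimitiveRoot ζ p) (e : ℕ) {k : ℕ}
    (f : MvPolynomial (Fin k) F) :
    (numSolutions (p ^ e) f : L) = ∑ a with a ^ p ^ e = a,
      ∑ x, traceChar F hζ (a * MvPolynomial.eval x f) := by
  rw [numSolutions, Nat.card_eq_fintype_card, Fintype.card_subtype, card_filter,
    Fintype.sum_prod_type, Nat.cast_sum, sum_comm]
  simp_rw [← card_filter, card_filter_eq_pow_sub_self hζ]

variable {Γ₀ : Type*} [LinearOrderedCommGroupWithZero Γ₀] {v : Valuation L Γ₀}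
  {j : WittVector p F →+* L} {k : ℕ} {ι : Type*} [Fintype ι]

/-- The coefficient of `∏ s, c s ^ r s` when the number of solutions of
`∑ s, c s * x ^ t s = y ^ q - y` is expanded in the Teichmüller lifts of the coefficients `c s`. -/
noncomputable def expansionCoeff (j : WittVector p F →+* L) (hζ : IsPrimitiveRoot ζ p) (q : ℕ)
    (t : ι → Fin k → ℕ) (r : ι → ℕ) : L :=
  (∏ s, traceCoeff j hζ (r s)) * (∑ a with a ^ q = a, teich j a ^ ∑ s, r s) *
    ∏ i, ∑ z, teich j z ^ ∑ s, r s * t s i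

namespace IsWittValuation

theorem numSolutions_eq_sum_expansionCoeff (hv : IsWittValuation v j) (hζ : IsPrimitiveRoot ζ p)
    (e : ℕ) {f : MvPolynomial (Fin k) F} [DecidableEq ι] {c : ι → F} {t : ι → Fin k → ℕ}
    (hf : ∀ x, MvPolynomial.eval x f = ∑ s, c s * ∏ i, x i ^ t s i) :
    (numSolutions (p ^ e) f : L) = ∑ r ∈ Fintype.piFinset fun _ => range (Fintype.card F),
      expansionCoeff j hζ (p ^ e) t r * ∏ s, teich j (c s) ^ r s := by
  rw [numSolutions_eq_sum hζ]
  simp_rw [hf, hv.traceChar_mul_sum_monomial hζ]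
  rw [sum_congr rfl fun a _ => sum_comm, sum_comm]
  refine sum_congr rfl fun r _ => ?_
  simp_rw [← mul_sum, ← sum_mul]
  rw [← mul_sum, expansionCoeff, prod_univ_sum, Fintype.piFinset_univ]
  ring

end IsWittValuation

end Counting

section PolynomialOfCoeffs

variable {R : Type*} [CommSemiring R] {k : ℕ} {ι : Type*} [Fintype ι]

theorem sum_mem_degreeSet {f : MvPolynomial (Fin k) R} {n : Fin k →₀ ℕ} (hn : n ∈ f.support) :
    ∑ i, n i ∈ degreeSet f := by
  intro h
  have hcoeff := congrArg (MvPolynomial.coeff n) h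
  rw [MvPolynomial.coeff_homogeneousComponent, Finsupp.degree_eq_sum, if_pos rfl,
    MvPolynomial.coeff_zero] at hcoeff
  exact MvPolynomial.mem_support_iff.1 hn hcoeff

/-- The polynomial with prescribed coefficients on a finite family of monomials. -/
noncomputable def polyOfCoeffs (t : ι → Fin k → ℕ) (c : ι → R) : MvPolynomial (Fin k) R :=
  ∑ s, MvPolynomial.monomial (Finsupp.equivFunOnFinite.symm (t s)) (c s)

theorem eval_polyOfCoeffs (t : ι → Fin k → ℕ) (c : ι → R) (x : Fin k → R) :
    MvPolynomial.eval x (polyOfCoeffs t c) = ∑ s, c s * ∏ i, x i ^ t s i := by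
  rw [polyOfCoeffs, map_sum]
  refine sum_congr rfl fun s _ => ?_
  rw [MvPolynomial.eval_monomial, Finsupp.prod_fintype _ _ fun _ => pow_zero _]
  rfl

theorem degreeSet_polyOfCoeffs_subset {t : ι → Fin k → ℕ} {D : Set ℕ} (ht : ∀ s, ∑ i, t s i ∈ D)
    (c : ι → R) : degreeSet (polyOfCoeffs t c) ⊆ D := by
  intro d hd
  by_contra hdD
  refine hd ((map_sum _ _ _).trans (sum_eq_zero fun s _ => ?_))
  have hs := MvPolynomial.isHomogeneous_monomial (c s)
    (Finsupp.degree_eq_sum (Finsupp.equivFunOnFinite.symm (t s)))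
  exact (MvPolynomial.homogeneousComponent_of_mem hs).trans
    (if_neg fun h => hdD (by rw [h]; exact ht s))

end PolynomialOfCoeffs

section PadicValuation

variable {p : ℕ} [Fact p.Prime] {F : Type*} [Field F] [CharP F p] {L : Type*} [Field L]
  {Γ₀ : Type*} [LinearOrderedCommGroupWithZero Γ₀] {v : Valuation L Γ₀}
  {j : WittVector p F →+* L} {ζ : L}

namespace IsWittValuation

theorem valuation_natCast (hv : IsWittValuation v j) (hζ : IsPrimitiveRoot ζ p) {N : ℕ}
    (hN : N ≠ 0) : v (N : L) = v (ζ - 1) ^ ((p - 1) * padicValNat p N) := by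
  have hp : p.Prime := Fact.out
  conv_lhs => rw [← Nat.ordProj_mul_ordCompl_eq_self N p, Nat.cast_mul, Nat.cast_pow, map_mul,
    map_pow, hv.valuation_natCast_eq_one (Nat.not_dvd_ordCompl hp hN), mul_one,
    valuation_natCast_eq_pow hζ, ← pow_mul, Nat.factorization_def N hp]

theorem le_valP_of_valuation_le (hv : IsWittValuation v j) (hζ : IsPrimitiveRoot ζ p) {N M : ℕ}
    (h : v (N : L) ≤ v (ζ - 1) ^ M) :
    ((1 / ((p : ℚ) - 1) * M : ℚ) : WithTop ℚ) ≤ valP p N := by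
  have hp : (1 : ℚ) < p := by exact_mod_cast (Fact.out : p.Prime).one_lt
  rw [valP]
  split_ifs with hN
  · exact le_top
  rw [hv.valuation_natCast hζ hN,
    pow_le_pow_iff_right_of_lt_one₀ (valuation_sub_one_pos hζ)
      (hv.valuation_sub_one_lt_one hζ)] at h
  rw [WithTop.coe_le_coe, one_div, inv_mul_le_iff₀ (sub_pos.2 hp)]
  rw [← Nat.cast_pred (Fact.out : p.Prime).pos]
  exact_mod_cast h

theorem valP_eq_of_valuation_eq (hv : IsWittValuation v j) (hζ : IsPrimitiveRoot ζ p) {N M : ℕ}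
    (h : v (N : L) = v (ζ - 1) ^ M) :
    valP p N = ((1 / ((p : ℚ) - 1) * M : ℚ) : WithTop ℚ) := by
  have hp : (1 : ℚ) < p := by exact_mod_cast (Fact.out : p.Prime).one_lt
  have hN : N ≠ 0 := by
    rintro rfl
    rw [Nat.cast_zero, map_zero] at h
    exact (pow_pos (valuation_sub_one_pos hζ) M).ne h
  rw [hv.valuation_natCast hζ hN] at h
  have hM := pow_right_injective₀ (valuation_sub_one_pos hζ) (hv.valuation_sub_one_lt_one hζ).ne h
  rw [valP, if_neg hN, ← hM, Nat.cast_mul, Nat.cast_pred (Fact.out : p.Prime).pos, one_div,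
    inv_mul_cancel_left₀ (sub_pos.2 hp).ne']

end IsWittValuation

end PadicValuation

section ValuationOfCoefficients

variable {p : ℕ} [Fact p.Prime] {F : Type*} [Field F]
  {L : Type*} [Field L] {Γ₀ : Type*} [LinearOrderedCommGroupWithZero Γ₀] {v : Valuation L Γ₀}
  {j : WittVector p F →+* L} {ζ : L}

theorem valuation_sum_teich_pow_le_one [Finite F] (s : Finset F) (u : ℕ) :
    v (∑ a ∈ s, teich j a ^ u) ≤ 1 :=
  v.map_sum_le fun a _ => by
    rw [map_pow]
    exact pow_le_one₀ zero_le (valuation_mulChar_le_one _ a)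

variable [Fintype F] [CharP F p] {q n m k : ℕ} {ι : Type*} [Fintype ι]

namespace IsWittValuation

theorem valuation_sum_filter_teich_pow [DecidableEq F] (hv : IsWittValuation v j) (hq : 1 < q)
    (hpq : p ∣ q) (hqF : q - 1 ∣ Fintype.card F - 1) {u : ℕ} (hu : 0 < u) (hqu : q - 1 ∣ u) :
    v (∑ a with a ^ q = a, teich j a ^ u) = 1 := by
  rw [sum_pow_filter_pow_eq_self hv.teich_injective hq hqF, if_neg hu.ne', if_pos hqu]
  exact hv.valuation_natCast_pred_eq_one (by lia) hpq

theorem valuation_sum_teich_pow (hv : IsWittValuation v j) (hζ : IsPrimitiveRoot ζ p)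
    (hF : Fintype.card F = p ^ n) {u : ℕ} (hu : Fintype.card F - 1 ∣ u) :
    v (∑ z, teich j z ^ u) = v (ζ - 1) ^ (if u = 0 then n * (p - 1) else 0) := by
  rw [sum_pow_of_mulChar_injective hv.teich_injective, if_pos hu]
  split_ifs
  · rw [hF, Nat.cast_pow, map_pow, valuation_natCast_eq_pow hζ, ← pow_mul, mul_comm]
  · rw [pow_zero]
    exact hv.valuation_natCast_pred_eq_one Fintype.card_pos
      ((CharP.cast_eq_zero_iff F p _).1 (FiniteField.cast_card_eq_zero F))

theorem valuation_prod_sum_teich_pow (hv : IsWittValuation v j) (hζ : IsPrimitiveRoot ζ p)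
    (hF : Fintype.card F = p ^ n) {u : ι → ℕ} (hu : ∀ i, Fintype.card F - 1 ∣ u i) :
    v (∏ i, ∑ z, teich j z ^ u i) = v (ζ - 1) ^ (#{i | u i = 0} * (n * (p - 1))) := by
  rw [map_prod, prod_congr rfl fun i _ => hv.valuation_sum_teich_pow hζ hF (hu i),
    prod_pow_eq_pow_sum, ← sum_filter, sum_const, smul_eq_mul]

variable [DecidableEq F] [Algebra (ZMod p) F] {t : ι → Fin k → ℕ} {r : ι → ℕ}

theorem dvd_of_expansionCoeff_ne_zero (hv : IsWittValuation v j) {hζ : IsPrimitiveRoot ζ p}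
    (hq : 1 < q) (hqF : q - 1 ∣ Fintype.card F - 1) (h : expansionCoeff j hζ q t r ≠ 0) :
    q - 1 ∣ ∑ s, r s ∧ ∀ i, Fintype.card F - 1 ∣ ∑ s, r s * t s i := by
  refine ⟨?_, fun i => ?_⟩
  · have hsum := right_ne_zero_of_mul (left_ne_zero_of_mul h)
    rw [sum_pow_filter_pow_eq_self hv.teich_injective hq hqF] at hsum
    split_ifs at hsum with hu hu
    · exact hu ▸ dvd_zero _
    · exact hu
    · exact absurd rfl hsum
  · have hsum := prod_ne_zero_iff.1 (right_ne_zero_of_mul h) i (mem_univ i)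
    rw [sum_pow_of_mulChar_injective hv.teich_injective] at hsum
    split_ifs at hsum with hu hu
    · exact hu ▸ dvd_zero _
    · exact hu
    · exact absurd rfl hsum

theorem valuation_expansionCoeff (hv : IsWittValuation v j) (hζ : IsPrimitiveRoot ζ p)
    (hF : Fintype.card F = p ^ n) (hr : ∀ s, r s < Fintype.card F)
    (hcol : ∀ i, Fintype.card F - 1 ∣ ∑ s, r s * t s i) :
    v (expansionCoeff j hζ q t r) = v (∑ a with a ^ q = a, teich j a ^ ∑ s, r s) *
      v (ζ - 1) ^
        (∑ s, digitSum p (r s) + #{i | ∑ s, r s * t s i = 0} * (n * (p - 1))) := by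
  rw [expansionCoeff, map_mul, map_mul, map_prod,
    prod_congr rfl fun s _ => hv.valuation_traceCoeff hζ hF (hr s), prod_pow_eq_pow_sum,
    hv.valuation_prod_sum_teich_pow hζ hF hcol, mul_comm (_ ^ _), mul_assoc, ← pow_add]

theorem valuation_expansionCoeff_le (hv : IsWittValuation v j) (hζ : IsPrimitiveRoot ζ p)
    (hn : 0 < n) (hq : 1 < q) (hF : Fintype.card F = q ^ m) (hQ : q ^ m = p ^ n) {D : Finset ℕ}
    (hD : D ⊆ Icc 0 (k * (q ^ m - 1))) (hDpos : ∃ d ∈ D, 0 < d) {M : ℕ}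
    (hM : ∀ r, Feasible q m k D r → M ≤ ∑ x, digitSum p (r x)) (ht : ∀ s, ∑ i, t s i ∈ D)
    (hr : ∀ s, r s < Fintype.card F) : v (expansionCoeff j hζ q t r) ≤ v (ζ - 1) ^ M := by
  have hqF : q - 1 ∣ Fintype.card F - 1 := hF ▸ Nat.sub_one_dvd_pow_sub_one q m
  rcases eq_or_ne (expansionCoeff j hζ q t r) 0 with h0 | h0
  · rw [h0, map_zero]
    exact zero_le
  obtain ⟨hsum, hcol⟩ := hv.dvd_of_expansionCoeff_ne_zero hq hqF h0
  obtain ⟨r', hr', hle⟩ := exists_feasible_of_modEq (Fact.out : p.Prime).one_lt hn hQ hD hDpos r t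
    ht (Nat.modEq_zero_iff_dvd.2 hsum) fun i => Nat.modEq_zero_iff_dvd.2 (hF ▸ hcol i)
  rw [hv.valuation_expansionCoeff hζ (hF.trans hQ) hr hcol]
  exact (mul_le_of_le_one_left' (valuation_sum_teich_pow_le_one _ _)).trans
    (pow_le_pow_of_le_one zero_le (hv.valuation_sub_one_lt_one hζ).le ((hM r' hr').trans hle))

theorem valuation_expansionCoeff_of_feasible (hv : IsWittValuation v j)
    (hζ : IsPrimitiveRoot ζ p) (hk : 0 < k) (hq : 1 < q) (hpq : p ∣ q)
    (hF : Fintype.card F = q ^ m) (hQ : q ^ m = p ^ n) {D : Finset ℕ}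
    {r : exponentSet (q ^ m) k D → ℕ} (hr : Feasible q m k D r) :
    v (expansionCoeff j hζ q (fun s => s.1) r) = v (ζ - 1) ^ ∑ s, digitSum p (r s) := by
  have hrlt (s) : r s < Fintype.card F :=
    (hr.le s).trans_lt (by rw [← hF]; exact Nat.sub_one_lt Fintype.card_ne_zero)
  have hqF : q - 1 ∣ Fintype.card F - 1 := hF ▸ Nat.sub_one_dvd_pow_sub_one q m
  have hcol (i) : Fintype.card F - 1 ∣ ∑ s, r s * s.1 i := by
    rw [hF]
    exact hr.weighted_dvd i
  have hempty : #{i | ∑ s, r s * s.1 i = 0} = 0 :=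
    card_eq_zero.2 (filter_eq_empty_iff.2 fun i _ => (hr.weighted_pos i).ne')
  have hpos : 0 < ∑ s, r s := by
    obtain ⟨s, hs, hrs⟩ := exists_ne_zero_of_sum_ne_zero (hr.weighted_pos ⟨0, hk⟩).ne'
    exact sum_pos' (fun _ _ => zero_le) ⟨s, hs, Nat.pos_of_ne_zero (left_ne_zero_of_mul hrs)⟩
  rw [hv.valuation_expansionCoeff hζ (hF.trans hQ) hrlt hcol, hempty, zero_mul, add_zero,
    hv.valuation_sum_filter_teich_pow hq hpq hqF hpos (Nat.modEq_zero_iff_dvd.1 hr.sum_modEq),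
    one_mul]

end IsWittValuation

end ValuationOfCoefficients

section NumberOfSolutions

variable {p : ℕ} [Fact p.Prime] {F : Type*} [Field F] [Fintype F] [CharP F p]
  [Algebra (ZMod p) F] {L : Type*} [Field L] {Γ₀ : Type*} [LinearOrderedCommGroupWithZero Γ₀]
  {v : Valuation L Γ₀} {j : WittVector p F →+* L} {ζ : L} {e m k : ℕ} {D : Finset ℕ}

namespace IsWittValuation

theorem valuation_numSolutions_le (hv : IsWittValuation v j) (hζ : IsPrimitiveRoot ζ p)
    (he : 0 < e) (hm : 0 < m) (hF : Fintype.card F = (p ^ e) ^ m)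
    (hD : D ⊆ Icc 0 (k * ((p ^ e) ^ m - 1))) (hDpos : ∃ d ∈ D, 0 < d) {M : ℕ}
    (hM : ∀ r, Feasible (p ^ e) m k D r → M ≤ ∑ x, digitSum p (r x))
    {f : MvPolynomial (Fin k) F} (hf : degreeSet f ⊆ D) :
    v (numSolutions (p ^ e) f : L) ≤ v (ζ - 1) ^ M := by
  classical
  have hq : 1 < p ^ e := Nat.one_lt_pow he.ne' (Fact.out : p.Prime).one_lt
  let t : f.support → Fin k → ℕ := fun s i => s.1 i
  have heval (x : Fin k → F) : MvPolynomial.eval x f =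
      ∑ s : f.support, f.coeff s.1 * ∏ i, x i ^ t s i := by
    rw [MvPolynomial.eval_eq', ← sum_coe_sort]
  rw [hv.numSolutions_eq_sum_expansionCoeff hζ e heval]
  refine v.map_sum_le fun r hr => ?_
  have hcoeff : v (expansionCoeff j hζ (p ^ e) t r) ≤ v (ζ - 1) ^ M := by
    refine hv.valuation_expansionCoeff_le hζ (Nat.mul_pos he hm) hq hF (pow_mul p e m).symm hD hDpos
      hM (fun s => ?_) fun s => ?_
    · exact hf (sum_mem_degreeSet s.2)
    · exact mem_range.1 (Fintype.mem_piFinset.1 hr s)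
  rw [map_mul, map_prod]
  refine (mul_le_of_le_one_right' (prod_le_one' fun s _ => ?_)).trans hcoeff
  rw [map_pow]
  exact pow_le_one₀ zero_le (valuation_mulChar_le_one _ _)

theorem exists_valuation_numSolutions_eq (hv : IsWittValuation v j) (hζ : IsPrimitiveRoot ζ p)
    (he : 0 < e) (hm : 0 < m) (hF : Fintype.card F = (p ^ e) ^ m)
    (hD : D ⊆ Icc 0 (k * ((p ^ e) ^ m - 1))) (hDpos : ∃ d ∈ D, 0 < d)
    {r₀ : exponentSet ((p ^ e) ^ m) k D → ℕ} (hr₀ : Feasible (p ^ e) m k D r₀)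
    (hmin : ∀ r, Feasible (p ^ e) m k D r → ∑ x, digitSum p (r₀ x) ≤ ∑ x, digitSum p (r x)) :
    ∃ f : MvPolynomial (Fin k) F, degreeSet f ⊆ D ∧
      v (numSolutions (p ^ e) f : L) = v (ζ - 1) ^ ∑ x, digitSum p (r₀ x) := by
  classical
  have hq : 1 < p ^ e := Nat.one_lt_pow he.ne' (Fact.out : p.Prime).one_lt
  have hk : 0 < k := by
    obtain ⟨d, hdD, hd⟩ := hDpos
    exact Nat.pos_of_mul_pos_right (hd.trans_le (mem_Icc.1 (hD hdD)).2)
  have hlt (s) : r₀ s < Fintype.card F :=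
    (hr₀.le s).trans_lt (by rw [← hF]; exact Nat.sub_one_lt Fintype.card_ne_zero)
  let t : exponentSet ((p ^ e) ^ m) k D → Fin k → ℕ := fun s => s.1
  obtain ⟨c, hc⟩ := exists_valuation_coeff_le_valuation_eval
    (fun a => valuation_mulChar_le_one (teich j) a) (fun _ _ => hv.valuation_teich_sub_teich)
    (expansionCoeff j hζ (p ^ e) t) hlt
  have hdeg : degreeSet (polyOfCoeffs t c) ⊆ D :=
    degreeSet_polyOfCoeffs_subset (fun s => by exact (mem_filter.1 s.2).2) c
  rw [← hv.numSolutions_eq_sum_expansionCoeff hζ e (eval_polyOfCoeffs t c),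
    hv.valuation_expansionCoeff_of_feasible hζ hk hq (dvd_pow_self p he.ne') hF
      (pow_mul p e m).symm hr₀] at hc
  exact ⟨_, hdeg, (hv.valuation_numSolutions_le hζ he hm hF hD hDpos hmin hdeg).antisymm hc⟩

end IsWittValuation

end NumberOfSolutions

section Minimum

variable {p q m n k Q : ℕ} {D : Finset ℕ}

theorem exists_pos_mem_of_ne_singleton_zero (hDne : D.Nonempty) (hD0 : D ≠ {0}) :
    ∃ d ∈ D, 0 < d := by
  by_contra! h
  exact hD0 (eq_singleton_iff_nonempty_unique_mem.2 ⟨hDne, fun d hd => Nat.le_zero.1 (h d hd)⟩)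

theorem exists_feasible_forall_sum_digitSum_le (hp : 1 < p) (hn : 0 < n) (hQ : q ^ m = p ^ n)
    (hD : D ⊆ Icc 0 (k * (q ^ m - 1))) (hDpos : ∃ d ∈ D, 0 < d) :
    ∃ r₀, Feasible q m k D r₀ ∧
      ∀ r, Feasible q m k D r → ∑ x, digitSum p (r₀ x) ≤ ∑ x, digitSum p (r x) := by
  obtain ⟨r, hr, -⟩ := exists_feasible_of_modEq hp hn hQ hD hDpos (ι := Empty) (fun _ => 0)
    (fun _ _ => 0) (fun s => s.elim) rfl fun _ => rfl
  obtain ⟨r₀, hr₀, hmin⟩ := exists_minimalFor_of_wellFoundedLT (Feasible q m k D)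
    (fun r => ∑ x, digitSum p (r x)) ⟨r, hr⟩
  exact ⟨r₀, hr₀, fun r hr => (le_total _ _).elim id (hmin hr)⟩

theorem objective_eq_mul_natCast (r : exponentSet Q k D → ℕ) :
    objective p Q k D r = 1 / ((p : ℚ) - 1) * (∑ t, digitSum p (r t) : ℕ) := by
  rw [objective, Nat.cast_sum]

theorem objective_le_objective (hp : 1 < p) {r s : exponentSet Q k D → ℕ}
    (h : ∑ t, digitSum p (r t) ≤ ∑ t, digitSum p (s t)) :
    objective p Q k D r ≤ objective p Q k D s := by
  have hp' : (1 : ℚ) < p := by exact_mod_cast hp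
  rw [objective_eq_mul_natCast, objective_eq_mul_natCast]
  exact mul_le_mul_of_nonneg_left (by exact_mod_cast h) (one_div_pos.2 (sub_pos.2 hp')).le

end Minimum

theorem mainTheorem3 (p e q m k : ℕ) (hp : p.Prime) (he : 0 < e) (hq : q = p ^ e) (hm : 0 < m)
    (F : Type*) [Field F] [Fintype F] (hF : Fintype.card F = q ^ m)
    (D : Finset ℕ) (hD : D ⊆ Finset.Icc 0 (k * (q ^ m - 1)))
    (hDne : D.Nonempty) (hD0 : D ≠ {0}) :
    ∃ μ : ℚ,
      IsLeast {v : ℚ | ∃ r : exponentSet (q ^ m) k D → ℕ,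
        Feasible q m k D r ∧ objective p (q ^ m) k D r = v} μ ∧
      (∀ f : MvPolynomial (Fin k) F, degreeSet f ⊆ ↑D →
        (μ : WithTop ℚ) ≤ valP p (numSolutions q f)) ∧
      ∃ f : MvPolynomial (Fin k) F, degreeSet f ⊆ ↑D ∧
        valP p (numSolutions q f) = (μ : WithTop ℚ) := by
  subst hq
  have : Fact p.Prime := ⟨hp⟩
  have : CharP F p := charP_of_card_eq_prime_pow (f := e * m) (by rw [hF, pow_mul])
  let _ : Algebra (ZMod p) F := ZMod.algebra F p
  have hDpos := exists_pos_mem_of_ne_singleton_zero hDne hD0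
  obtain ⟨r₀, hr₀, hmin⟩ := exists_feasible_forall_sum_digitSum_le hp.one_lt (Nat.mul_pos he hm)
    (pow_mul p e m).symm hD hDpos
  obtain ⟨L, _, Γ₀, _, v, j, ζ, hv, hζ⟩ := exists_isWittValuation p F
  refine ⟨objective p ((p ^ e) ^ m) k D r₀, ⟨⟨r₀, hr₀, rfl⟩, ?_⟩, fun f hf => ?_, ?_⟩
  · rintro _ ⟨r, hr, rfl⟩
    exact objective_le_objective hp.one_lt (hmin r hr)
  · rw [objective_eq_mul_natCast]
    exact hv.le_valP_of_valuation_le hζ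
      (hv.valuation_numSolutions_le hζ he hm hF hD hDpos hmin hf)
  · rw [objective_eq_mul_natCast]
    obtain ⟨f, hf, hN⟩ := hv.exists_valuation_numSolutions_eq hζ he hm hF hD hDpos hr₀ hmin
    exact ⟨f, hf, hv.valP_eq_of_valuation_eq hζ hN⟩
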